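/- Let $K$ be a field and let $\mathbf a_1,\dots,\mathbf a_m$ and $\mathbf b_1,\dots,\mathbf b_n$ be nonzero vectors in $\mathbb N^r$ (for instance the minimal generators of the semigroups below). Let $S_1=\mathbb N\{\mathbf a_1,\dots,\mathbf a_m\}$, $S_2=\mathbb N\{\mathbf b_1,\dots,\mathbf b_n\}$, and let $S=S_1+S_2=\mathbb N\{\mathbf a_1,\dots,\mathbf a_m,\mathbf b_1,\dots,\mathbf b_n\}$ be the gluing of $S_1$ and $S_2$ by $\alpha$, that is, $0\ne\alpha\in S_1\cap S_2$ and $\mathbb ZS_1\cap\mathbb ZS_2=\mathbb Z\alpha$. For a semigroup $T$ generated by given nonzero vectors $\mathbf c_1,\dots,\mathbf c_k\in\mathbb N^r$, the polynomial ring $R_T=K[z_1,\dots,z_k]$ is graded by $\deg z_j=\mathbf c_j$, and $K[T]=R_T/I_T$, where $I_T$ is the kernel of the map $z_j\mapsto \mathbf t^{\mathbf c_j}$. A minimal graded free resolution of $K[T]$ is an exact complex of graded free modules of finite rank $\cdots\to F_1\to F_0\to K[T]\to 0$ over $R_T$ with degree-preserving maps such that the image of $F_{i+1}\to F_i$ lies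 in $(z_1,\dots,z_k)F_i$ for all $i\ge 0$. If $F_i=\bigoplus_{j=1}^{\beta_i}R_T[-s_{i,j}]$, then $\mathcal B_i(T)$ denotes the multiset $\{s_{i,1},\dots,s_{i,\beta_i}\}$ of $i$-Betti $T$-degrees; in particular $\mathcal B_0(T)=\{0\}$, and $\mathcal B_i(T)=\emptyset$ when $i$ exceeds the projective dimension of $K[T]$. Here $S_1$, $S_2$, $S$ are taken with the generators $\mathbf a_j$; $\mathbf b_j$; and $\mathbf a_1,\dots,\mathbf a_m,\mathbf b_1,\dots,\mathbf b_n$, respectively. Given minimal graded free resolutions of $K[S_1]$ and $K[S_2]$, with Betti degrees $\mathcal B_p(S_1)$ and $\mathcal B_q(S_2)$, the ring $K[S]$ has a minimal graded free resolution, and the Betti degrees of every such resolution of $K[S]$ satisfy, for every integer $i\ge 0$, $$\mathcal B_i(S)=\Bigl[\bigcup_{p+q=i}\bigl(\mathcal B_p(S_1)+\mathcal B_q(S_2)\bigr)\Bigr]\cup\Bigl[\bigcup_{p+q=i-1}\bigl(\mathcal B_p(S_1)+\mathcal B_q(S_2)+\{\alpha\}\bigr)\Bigr],$$ where $p,q\ge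 0$, and sums and unions of multisets are taken with multiplicities. -/

import Mathlib

namespace AffineSemigroup

/-- The affine semigroup `ℕ{c_x : x}` in `ℕ^r` generated by the family `c`. -/
def semigroup {r : ℕ} {σ : Type} (c : σ → Fin r → ℕ) : AddSubmonoid (Fin r → ℕ) :=
  AddSubmonoid.closure (Set.range c)

/-- The inclusion of `ℕ^r` in `ℤ^r`. -/
def toInt {r : ℕ} (v : Fin r → ℕ) : Fin r → ℤ := fun k => (v k : ℤ)

/-- The subgroup `ℤS` of `ℤ^r` generated by `S`. -/
def groupOf {r : ℕ} (S : AddSubmonoid (Fin r → ℕ)) : AddSubgroup (Fin r → ℤ) :=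
  AddSubgroup.closure (toInt '' (S : Set (Fin r → ℕ)))

/-- `S` is the gluing of `S₁` and `S₂` by `α`: `S = S₁ + S₂`, `0 ≠ α ∈ S₁ ∩ S₂` and
`ℤS₁ ∩ ℤS₂ = ℤα`. -/
structure IsGluing {r : ℕ} (S S₁ S₂ : AddSubmonoid (Fin r → ℕ)) (α : Fin r → ℕ) : Prop where
  eq_sup : S = S₁ ⊔ S₂
  ne_zero : α ≠ 0
  mem_left : α ∈ S₁
  mem_right : α ∈ S₂
  inf_eq : groupOf S₁ ⊓ groupOf S₂ = AddSubgroup.zmultiples (toInt α)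

/-- The graded homomorphism `R = K[X_x : x] → K[ℕ^r]`, `X_x ↦ t^{c_x}`, whose image is the affine
semigroup ring `K[S]`, for `S` generated by `c`. -/
noncomputable def toricMap (K : Type*) [Field K] {r : ℕ} {σ : Type} (c : σ → Fin r → ℕ) :
    MvPolynomial σ K →ₐ[K] AddMonoidAlgebra K (Fin r → ℕ) :=
  MvPolynomial.aeval (fun x => AddMonoidAlgebra.single (c x) (1 : K))

/-- The toric ideal `I_S`, so that `K[S] ≅ R ⧸ I_S`. -/
noncomputable def toricIdeal (K : Type*) [Field K] {r : ℕ} {σ : Type} (c : σ → Fin r → ℕ) :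
    Ideal (MvPolynomial σ K) :=
  RingHom.ker (toricMap K c)

/-- `v` is a homogeneous element of degree `t` in the graded free module `⨁_k R(-s_k)`, where
`R = K[X_x : x]` is graded by `deg X_x = c_x`: every monomial of the coordinate `v_k` has degree
`t - s_k`. -/
def IsHomogeneousVector {K : Type*} [Field K] {r : ℕ} {σ : Type} (c : σ → Fin r → ℕ) {β : ℕ}
    (s : Fin β → Fin r → ℕ) (v : Fin β → MvPolynomial σ K) (t : Fin r → ℕ) : Prop :=
  ∀ k, ∀ e ∈ (v k).support, Finsupp.weight c e + s k = t

/-- A minimal graded free resolution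
`⋯ → R^{β_2} → R^{β_1} → R^{β_0} → R ⧸ I_S → 0` of the semigroup ring `K[S] ≅ R ⧸ I_S` over
`R = K[X_x : x]` graded by `deg X_x = c_x`, where `R^{β_i} = ⨁_j R(-deg i j)`. -/
structure MinimalResolution (K : Type*) [Field K] {r : ℕ} {σ : Type} (c : σ → Fin r → ℕ) where
  /-- The ranks `β_i`. -/
  rank : ℕ → ℕ
  /-- The degrees of the basis elements. -/
  deg : (i : ℕ) → Fin (rank i) → Fin r → ℕ
  /-- The differentials. -/
  d : (i : ℕ) →
    (Fin (rank (i + 1)) → MvPolynomial σ K) →ₗ[MvPolynomial σ K] (Fin (rank i) → MvPolynomial σ K)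
  /-- The augmentation. -/
  aug : (Fin (rank 0) → MvPolynomial σ K) →ₗ[MvPolynomial σ K] (MvPolynomial σ K ⧸ toricIdeal K c)
  /-- The differentials preserve degrees (it suffices to say so on the basis elements). -/
  d_homogeneous : ∀ i j, IsHomogeneousVector c (deg i) (d i (Pi.single j 1)) (deg (i + 1) j)
  /-- The augmentation preserves degrees; the component of degree `t` of `R ⧸ I_S` is the image of
  the component of degree `t` of `R`. -/
  aug_homogeneous : ∀ j, ∃ p : MvPolynomial σ K,
    MvPolynomial.IsWeightedHomogeneous c p (deg 0 j) ∧
      aug (Pi.single j 1) = Ideal.Quotient.mk (toricIdeal K c) p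
  aug_surjective : Function.Surjective aug
  exact_zero : Function.Exact (d 0) aug
  exact_succ : ∀ i, Function.Exact (d (i + 1)) (d i)
  /-- Minimality: the image of each differential lies in `𝔪 R^{β_i}`, `𝔪 = ⟨X_x : x⟩`. -/
  minimal : ∀ i, LinearMap.range (d i) ≤
    Ideal.span (Set.range (MvPolynomial.X : σ → MvPolynomial σ K)) •
      (⊤ : Submodule (MvPolynomial σ K) (Fin (rank i) → MvPolynomial σ K))

/-- The multiset of `i`-Betti degrees read off from a minimal graded free resolution. -/
def MinimalResolution.betti {K : Type*} [Field K] {r : ℕ} {σ : Type} {c : σ → Fin r → ℕ}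
    (F : MinimalResolution K c) (i : ℕ) : Multiset (Fin r → ℕ) :=
  Finset.univ.val.map (F.deg i)

/-- The sum `A + B = {a + b}` of two multisets, with multiplicities. (The `+` of Mathlib on
multisets, and so its `∑`, is the union with multiplicities.) -/
def sumset {M : Type*} [Add M] (A B : Multiset M) : Multiset M :=
  (A ×ˢ B).map (fun z => z.1 + z.2)

end AffineSemigroup

open AffineSemigroup

/-! Let x and y denote the variables belonging to S₁ and S₂. As α lies in both semigroups, α = deg
x^μ = deg y^ν for some exponents μ, ν; put ρ = x^μ - y^ν. If two monomials have the same degree in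
S, the difference of their x-degrees lies in ℤS₁ ∩ ℤS₂ = ℤα, so one monomial is carried to the other
by exchanging powers of x^μ and y^ν and by moves preserving both partial degrees. Hence the kernel
of K[x,y] → K[S] is generated by ρ and the kernel of K[x,y] → K[S₁ × S₂] = K[S₁] ⊗ K[S₂]
(`exists_sub_mul_gluingBinomial`).

The tensor product over K of the two given resolutions resolves K[S₁ × S₂]
(`TotalResolution.tensor`); exactness comes from K-linear contracting homotopies. This ring embeds
in the domain K[ℕ^r × ℕ^r], where ρ is nonzero, so the mapping cone of multiplication by ρ resolves
K[S] (`TotalResolution.cone`). It is minimal because ρ has no constant term. Its basis is two copies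
of the tensor basis, the second shifted by 1 in homological degree and by α in internal degree:
these are the two brackets of the formula.

Any two minimal graded resolutions have the same Betti degrees (`MinimalResolution.betti_eq`), since
comparison maps between them are mutually inverse modulo the variables.

Resolutions are handled as one free module with an endomorphism (`TotalResolution`), so that tensor
products and cones need no families indexed by homological degree; `MinimalResolution.total` and
`TotalResolution.toMinimal` translate. -/

namespace AffineSemigroup

open MvPolynomial
open scoped TensorProduct

/-! ### Truncating polynomials by exponent; the ideal of the variables. -/

section Filter

variable {K : Type*} [Field K] {σ : Type}

/-- The part of a polynomial supported on the exponents satisfying `P`. -/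
noncomputable def filterPart (P : (σ →₀ ℕ) → Prop) (p : MvPolynomial σ K) : MvPolynomial σ K :=
  open Classical in ∑ e ∈ p.support, if P e then monomial e (coeff e p) else 0

open Classical in
theorem coeff_filterPart (P : (σ →₀ ℕ) → Prop) (p : MvPolynomial σ K) (e : σ →₀ ℕ) :
    coeff e (filterPart P p) = if P e then coeff e p else 0 := by
  rw [filterPart, coeff_sum]
  rw [Finset.sum_eq_single e]
  · split_ifs <;> simp
  · intro b _ hb
    split_ifs <;> simp [coeff_monomial, hb]
  · intro h
    rw [notMem_support_iff] at h
    split_ifs <;> simp [h]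

theorem mem_support_filterPart {P : (σ →₀ ℕ) → Prop} {p : MvPolynomial σ K} {e : σ →₀ ℕ}
    (h : e ∈ (filterPart P p).support) : P e := by
  classical
  rw [mem_support_iff, coeff_filterPart] at h
  by_contra hP
  simp [hP] at h

/-- Every exponent of `q` turns the condition `P` into the same condition `Q` on the other factor,
so each term of the convolution can be filtered on the left. -/
theorem filterPart_mul {P Q : (σ →₀ ℕ) → Prop} (p q : MvPolynomial σ K)
    (h : ∀ e, ∀ e' ∈ q.support, P (e + e') ↔ Q e) :
    filterPart P (p * q) = filterPart Q p * q := by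
  classical
  ext e
  rw [coeff_filterPart, coeff_mul, coeff_mul,
    ← Finset.sum_const_zero (s := Finset.HasAntidiagonal.antidiagonal e), ← Finset.sum_ite_irrel]
  refine Finset.sum_congr rfl fun x hx => ?_
  rw [coeff_filterPart, ← Finset.HasAntidiagonal.mem_antidiagonal.mp hx]
  by_cases hq : x.2 ∈ q.support
  · simp only [h x.1 x.2 hq, ite_mul, zero_mul]
  · simp [notMem_support_iff.mp hq]

theorem filterPart_sum {P : (σ →₀ ℕ) → Prop} {ι : Type*} (s : Finset ι)
    (f : ι → MvPolynomial σ K) : filterPart P (∑ i ∈ s, f i) = ∑ i ∈ s, filterPart P (f i) := by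
  classical
  ext e
  simp only [coeff_filterPart, coeff_sum]
  split_ifs <;> simp

theorem filterPart_add {P : (σ →₀ ℕ) → Prop} (p q : MvPolynomial σ K) :
    filterPart P (p + q) = filterPart P p + filterPart P q := by
  classical
  ext e
  simp only [coeff_filterPart, coeff_add]
  split_ifs <;> simp

open Classical in
theorem filterPart_monomial (P : (σ →₀ ℕ) → Prop) (e : σ →₀ ℕ) (x : K) :
    filterPart P (monomial e x) = if P e then monomial e x else 0 := by
  ext e'
  rw [coeff_filterPart, coeff_monomial]
  by_cases h : e = e'
  · subst h
    by_cases hP : P e <;> simp [hP]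
  · by_cases hP : P e <;> simp [h, hP]

theorem filterPart_sub {P : (σ →₀ ℕ) → Prop} (p q : MvPolynomial σ K) :
    filterPart P (p - q) = filterPart P p - filterPart P q := by
  classical
  ext e
  simp only [coeff_filterPart, coeff_sub]
  split_ifs <;> simp

theorem filterPart_eq_self {P : (σ →₀ ℕ) → Prop} {p : MvPolynomial σ K}
    (h : ∀ e ∈ p.support, P e) : filterPart P p = p := by
  classical
  ext e
  rw [coeff_filterPart]
  split_ifs with hP
  · rfl
  · exact (notMem_support_iff.mp fun he => hP (h e he)).symm

theorem mem_span_range_X_iff (p : MvPolynomial σ K) :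
    p ∈ Ideal.span (Set.range (X : σ → MvPolynomial σ K)) ↔ constantCoeff p = 0 := by
  have := mem_pow_idealOfVars_iff (σ := σ) (R := K) 1 p
  rw [pow_one] at this
  rw [show Ideal.span (Set.range (X : σ → MvPolynomial σ K)) = idealOfVars σ K from rfl, this,
    constantCoeff_eq]
  constructor
  · intro h
    by_contra h0
    simpa using h 0 (mem_support_iff.mpr h0)
  · intro h x hx
    rw [Nat.one_le_iff_ne_zero, Ne, Finsupp.degree_eq_zero_iff]
    rintro rfl
    exact mem_support_iff.mp hx h

theorem mem_ideal_smul_top_iff {R ι : Type*} [CommRing R] [Finite ι] (I : Ideal R) (v : ι → R) :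
    v ∈ I • (⊤ : Submodule R (ι → R)) ↔ ∀ k, v k ∈ I := by
  classical
  have := Fintype.ofFinite ι
  constructor
  · intro h k
    refine Submodule.smul_induction_on h (fun r hr n _ => ?_) fun x y hx hy => ?_
    · exact I.mul_mem_right _ hr
    · exact I.add_mem hx hy
  · intro h
    rw [pi_eq_sum_univ v]
    exact Submodule.sum_mem _ fun k _ => Submodule.smul_mem_smul (h k) trivial

end Filter

/-! ### Graded components of free modules and of the toric ideal. -/

section Homogeneous

variable {K : Type*} [Field K] {r : ℕ} {σ : Type} {c : σ → Fin r → ℕ}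

theorem map_eq_sum {R M : Type*} [CommSemiring R] [AddCommMonoid M] [Module R M] {n : ℕ}
    (f : (Fin n → R) →ₗ[R] M) (v : Fin n → R) : f v = ∑ k, v k • f (Pi.single k 1) := by
  conv_lhs => rw [pi_eq_sum_univ' v]
  simp [map_sum]

theorem IsHomogeneousVector.map {β γ : ℕ} {s : Fin β → Fin r → ℕ} {t : Fin γ → Fin r → ℕ}
    {φ : (Fin β → MvPolynomial σ K) →ₗ[MvPolynomial σ K] (Fin γ → MvPolynomial σ K)}
    (hφ : ∀ j, IsHomogeneousVector c t (φ (Pi.single j 1)) (s j))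
    {v : Fin β → MvPolynomial σ K} {u : Fin r → ℕ} (hv : IsHomogeneousVector c s v u) :
    IsHomogeneousVector c t (φ v) u := by
  classical
  intro k e he
  rw [map_eq_sum φ v, Finset.sum_apply] at he
  obtain ⟨j, _, hj⟩ := Finset.mem_biUnion.mp (support_sum he)
  obtain ⟨e₁, h₁, e₂, h₂, rfl⟩ := Finset.mem_add.mp (support_mul _ _ hj)
  rw [map_add, add_assoc, hφ j k e₂ h₂, hv j e₁ h₁]

/-- The component of degree `t` of a vector of `⨁_k R(-s_k)`. -/
noncomputable def degreePart (c : σ → Fin r → ℕ) {β : ℕ} (s : Fin β → Fin r → ℕ)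
    (t : Fin r → ℕ) (v : Fin β → MvPolynomial σ K) : Fin β → MvPolynomial σ K :=
  fun k => filterPart (fun e => Finsupp.weight c e + s k = t) (v k)

theorem degreePart_homogeneous {β : ℕ} (s : Fin β → Fin r → ℕ)
    (t : Fin r → ℕ) (v : Fin β → MvPolynomial σ K) :
    IsHomogeneousVector c s (degreePart c s t v) t :=
  fun _ _ he => mem_support_filterPart he

/-- Column `j` of `φ` is homogeneous of degree `s j`, so it shifts every exponent condition
uniformly. This is what makes preimages replaceable by homogeneous ones. -/
theorem degreePart_map {β γ : ℕ} {s : Fin β → Fin r → ℕ} {t : Fin γ → Fin r → ℕ}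
    {φ : (Fin β → MvPolynomial σ K) →ₗ[MvPolynomial σ K] (Fin γ → MvPolynomial σ K)}
    (hφ : ∀ j, IsHomogeneousVector c t (φ (Pi.single j 1)) (s j))
    (v : Fin β → MvPolynomial σ K) (u : Fin r → ℕ) :
    degreePart c t u (φ v) = φ (degreePart c s u v) := by
  funext k
  rw [degreePart, map_eq_sum φ v, map_eq_sum φ (degreePart c s u v), Finset.sum_apply,
    Finset.sum_apply, filterPart_sum]
  refine Finset.sum_congr rfl fun j _ => ?_
  refine filterPart_mul _ _ fun e e' he' => ?_
  rw [map_add, add_assoc, hφ j k e' he']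

theorem degreePart_eq_self {β : ℕ} {s : Fin β → Fin r → ℕ} {v : Fin β → MvPolynomial σ K}
    {t : Fin r → ℕ} (h : IsHomogeneousVector c s v t) : degreePart c s t v = v :=
  funext fun k => filterPart_eq_self (h k)

theorem aeval_single_monomial {M : Type*} [AddCommMonoid M] (c : σ → M) (e : σ →₀ ℕ) (x : K) :
    aeval (fun y => AddMonoidAlgebra.single (c y) (1 : K)) (monomial e x) =
      AddMonoidAlgebra.single (Finsupp.weight c e) x := by
  rw [aeval_monomial, Finsupp.prod, ← Algebra.smul_def]
  simp only [AddMonoidAlgebra.single_pow, one_pow]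
  rw [AddMonoidAlgebra.prod_single]
  simp [Finsupp.weight_apply, Finsupp.sum]

theorem toricMap_monomial (c : σ → Fin r → ℕ) (e : σ →₀ ℕ) (x : K) :
    toricMap K c (monomial e x) = AddMonoidAlgebra.single (Finsupp.weight c e) x := by
  rw [toricMap, aeval_single_monomial]

/-- The toric ideal is homogeneous: the part of weight `t` of a polynomial maps to the single term
at `t` of its image. -/
theorem filterPart_mem_toricIdeal {p : MvPolynomial σ K} (hp : p ∈ toricIdeal K c)
    (t : Fin r → ℕ) : filterPart (fun e => Finsupp.weight c e = t) p ∈ toricIdeal K c := by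
  have key : ∀ q : MvPolynomial σ K,
      toricMap K c (filterPart (fun e => Finsupp.weight c e = t) q) =
        AddMonoidAlgebra.single t ((toricMap K c q).coeff t) := by
    intro q
    classical
    induction q using MvPolynomial.induction_on' with
    | monomial e x =>
      rw [filterPart_monomial, toricMap_monomial]
      split_ifs with h
      · rw [toricMap_monomial, h]
        simp
      · simp [AddMonoidAlgebra.coeff_single, h]
    | add p q hp hq => rw [filterPart_add, map_add, map_add, hp, hq]; simp
  rw [toricIdeal, RingHom.mem_ker] at hp ⊢
  change toricMap K c p = 0 at hp
  rw [key, hp]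
  simp

end Homogeneous

/-! ### Uniqueness of Betti degrees by comparison of resolutions. -/

section Uniqueness

variable {K : Type*} [Field K] {r : ℕ} {σ : Type} {c : σ → Fin r → ℕ}

namespace MinimalResolution

theorem exists_homogeneous_d (G : MinimalResolution K c) (i : ℕ)
    {v : Fin (G.rank i) → MvPolynomial σ K} {t : Fin r → ℕ}
    (hv : IsHomogeneousVector c (G.deg i) v t) (hr : v ∈ LinearMap.range (G.d i)) :
    ∃ w, IsHomogeneousVector c (G.deg (i + 1)) w t ∧ G.d i w = v := by
  obtain ⟨w, rfl⟩ := hr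
  exact ⟨degreePart c _ t w, degreePart_homogeneous _ _ _, by
    rw [← degreePart_map (G.d_homogeneous i), degreePart_eq_self hv]⟩

/-- The quotient carries no grading here, so the augmentation is written through homogeneous
polynomial lifts `q k`, and homogeneity of the toric ideal allows passing to degree `t`. -/
theorem exists_homogeneous_aug (G : MinimalResolution K c)
    {p : MvPolynomial σ K} {t : Fin r → ℕ} (hp : IsWeightedHomogeneous c p t) :
    ∃ w, IsHomogeneousVector c (G.deg 0) w t ∧
      G.aug w = Ideal.Quotient.mk (toricIdeal K c) p := by
  obtain ⟨w, hw⟩ := G.aug_surjective (Ideal.Quotient.mk (toricIdeal K c) p)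
  choose q hq hqa using G.aug_homogeneous
  have haug : ∀ w, G.aug w = Ideal.Quotient.mk (toricIdeal K c) (∑ k, w k * q k) := by
    intro w
    rw [map_eq_sum G.aug w, map_sum]
    refine Finset.sum_congr rfl fun k _ => ?_
    rw [hqa, map_mul]
    rfl
  refine ⟨degreePart c _ t w, degreePart_homogeneous _ _ _, ?_⟩
  rw [haug, Ideal.Quotient.eq] at hw ⊢
  have := filterPart_mem_toricIdeal hw t
  rw [filterPart_sub, filterPart_sum, filterPart_eq_self (p := p)
    (fun e he => hp (mem_support_iff.mp he))] at this
  convert this using 3 with k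
  refine (filterPart_mul _ _ fun e e' he' => ?_).symm
  rw [map_add, hq k (mem_support_iff.mp he')]

/-- A linear map out of a free module with prescribed values on the standard basis. -/
theorem exists_linearMap {R M : Type*} [CommRing R] [AddCommGroup M] [Module R M] {n : ℕ}
    (w : Fin n → M) : ∃ φ : (Fin n → R) →ₗ[R] M, ∀ j, φ (Pi.single j 1) = w j :=
  ⟨Fintype.linearCombination R w, fun j => by simp [Fintype.linearCombination_apply_single]⟩

theorem exists_lift_aug (F G : MinimalResolution K c) :
    ∃ φ : (Fin (F.rank 0) → MvPolynomial σ K) →ₗ[MvPolynomial σ K]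
        (Fin (G.rank 0) → MvPolynomial σ K),
      (∀ j, IsHomogeneousVector c (G.deg 0) (φ (Pi.single j 1)) (F.deg 0 j)) ∧
      ∀ x, G.aug (φ x) = F.aug x := by
  choose p hp hpa using F.aug_homogeneous
  choose w hw hwa using fun j => G.exists_homogeneous_aug (hp j)
  obtain ⟨φ, hφ⟩ := exists_linearMap (R := MvPolynomial σ K) w
  refine ⟨φ, fun j => by rw [hφ]; exact hw j, fun x => ?_⟩
  rw [map_eq_sum φ x, map_sum, map_eq_sum F.aug x]
  simp [hφ, hwa, hpa]

theorem exists_lift_d (F G : MinimalResolution K c) (i : ℕ)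
    {φ : (Fin (F.rank i) → MvPolynomial σ K) →ₗ[MvPolynomial σ K]
        (Fin (G.rank i) → MvPolynomial σ K)}
    (hφ : ∀ j, IsHomogeneousVector c (G.deg i) (φ (Pi.single j 1)) (F.deg i j))
    (hr : ∀ x, φ (F.d i x) ∈ LinearMap.range (G.d i)) :
    ∃ φ' : (Fin (F.rank (i + 1)) → MvPolynomial σ K) →ₗ[MvPolynomial σ K]
        (Fin (G.rank (i + 1)) → MvPolynomial σ K),
      (∀ j, IsHomogeneousVector c (G.deg (i + 1)) (φ' (Pi.single j 1)) (F.deg (i + 1) j)) ∧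
      ∀ x, G.d i (φ' x) = φ (F.d i x) := by
  choose w hw hwa using fun j =>
    G.exists_homogeneous_d i (IsHomogeneousVector.map hφ (F.d_homogeneous i j)) (hr _)
  obtain ⟨φ', hφ'⟩ := exists_linearMap (R := MvPolynomial σ K) w
  refine ⟨φ', fun j => by rw [hφ']; exact hw j, fun x => ?_⟩
  rw [map_eq_sum φ' x, map_sum, map_eq_sum (F.d i) x, map_sum]
  simp [hφ', hwa]

theorem exists_linear_lift {R M N : Type*} [CommRing R] [AddCommGroup M] [Module R M]
    [AddCommGroup N] [Module R N] {n : ℕ} (f : (Fin n → R) →ₗ[R] N) (g : M →ₗ[R] N)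
    (h : ∀ x, f x ∈ LinearMap.range g) : ∃ φ : (Fin n → R) →ₗ[R] M, ∀ x, g (φ x) = f x := by
  choose w hw using fun j : Fin n => h (Pi.single j 1)
  obtain ⟨φ, hφ⟩ := exists_linearMap (R := R) w
  refine ⟨φ, fun x => ?_⟩
  rw [map_eq_sum φ x, map_sum, map_eq_sum f x]
  simp [hφ, hw]

/-- The clauses are those that survive an induction on `i`. Sending boundaries to boundaries is what
lets `φ` and `ψ` be lifted once more, and the homotopy identity is needed only on boundaries. The
last clause, that `ψ ∘ φ` is the identity modulo the variables, is the outcome to be used. -/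
theorem comparison_step (F G : MinimalResolution K c) (i : ℕ) :
    ∃ (φ : (Fin (F.rank i) → MvPolynomial σ K) →ₗ[MvPolynomial σ K]
        (Fin (G.rank i) → MvPolynomial σ K))
      (ψ : (Fin (G.rank i) → MvPolynomial σ K) →ₗ[MvPolynomial σ K]
        (Fin (F.rank i) → MvPolynomial σ K))
      (h : (Fin (F.rank i) → MvPolynomial σ K) →ₗ[MvPolynomial σ K]
        (Fin (F.rank (i + 1)) → MvPolynomial σ K)),
      (∀ j, IsHomogeneousVector c (G.deg i) (φ (Pi.single j 1)) (F.deg i j)) ∧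
      (∀ j, IsHomogeneousVector c (F.deg i) (ψ (Pi.single j 1)) (G.deg i j)) ∧
      (∀ x, φ (F.d i x) ∈ LinearMap.range (G.d i)) ∧
      (∀ x, ψ (G.d i x) ∈ LinearMap.range (F.d i)) ∧
      (∀ x ∈ LinearMap.range (F.d i), x - ψ (φ x) = F.d i (h x)) ∧
      ∀ x, x - ψ (φ x) ∈ Ideal.span (Set.range (MvPolynomial.X : σ → MvPolynomial σ K)) •
      (⊤ : Submodule (MvPolynomial σ K) (Fin (F.rank i) → MvPolynomial σ K)) := by
  induction i with
  | zero =>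
    obtain ⟨φ, hφ, hφa⟩ := exists_lift_aug F G
    obtain ⟨ψ, hψ, hψa⟩ := exists_lift_aug G F
    have h0 : ∀ x, x - ψ (φ x) ∈ LinearMap.range (F.d 0) := fun x =>
      (F.exact_zero _).mp (by rw [map_sub, hψa, hφa, sub_self])
    obtain ⟨h, hh⟩ := exists_linear_lift (LinearMap.id - ψ ∘ₗ φ) (F.d 0) h0
    refine ⟨φ, ψ, h, hφ, hψ, fun x => (G.exact_zero _).mp ?_, fun x => (F.exact_zero _).mp ?_,
      fun x _ => (hh x).symm, fun x => F.minimal 0 (h0 x)⟩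
    · rw [hφa, (F.exact_zero _).mpr ⟨x, rfl⟩]
    · rw [hψa, (G.exact_zero _).mpr ⟨x, rfl⟩]
  | succ i ih =>
    obtain ⟨φ, ψ, h, hφ, hψ, hφr, hψr, hh, -⟩ := ih
    obtain ⟨φ', hφ', hφd⟩ := exists_lift_d F G i hφ hφr
    obtain ⟨ψ', hψ', hψd⟩ := exists_lift_d G F i hψ hψr
    -- Subtracting the previous homotopy makes the error a cycle, hence a boundary.
    have h0 : ∀ x, x - ψ' (φ' x) - h (F.d i x) ∈ LinearMap.range (F.d (i + 1)) := fun x =>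
      (F.exact_succ i _).mp (by
        rw [map_sub, map_sub, hψd, hφd, hh _ ⟨x, rfl⟩, sub_self])
    obtain ⟨h', hh'⟩ :=
      exists_linear_lift (LinearMap.id - ψ' ∘ₗ φ' - h ∘ₗ F.d i) (F.d (i + 1)) h0
    refine ⟨φ', ψ', h', hφ', hψ', fun x => (G.exact_succ i _).mp ?_,
      fun x => (F.exact_succ i _).mp ?_, ?_, fun x => ?_⟩
    · rw [hφd, (F.exact_succ i _).mpr ⟨x, rfl⟩, map_zero]
    · rw [hψd, (G.exact_succ i _).mpr ⟨x, rfl⟩, map_zero]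
    · rintro _ ⟨x, rfl⟩
      rw [hh']
      simp [(F.exact_succ i _).mpr ⟨x, rfl⟩]
    -- The boundary part is in 𝔪 times the module by minimality at this level; the term `h (F.d i
    -- x)` is so because `F.d i x` is and `h` is linear.
    · have h1 := F.minimal _ (h0 x)
      have h2 : F.d i x ∈ Ideal.span (Set.range (MvPolynomial.X : σ → MvPolynomial σ K)) •
        (⊤ : Submodule (MvPolynomial σ K) (Fin (F.rank i) → MvPolynomial σ K)) :=
        F.minimal i ⟨x, rfl⟩
      have h3 := Submodule.mem_map_of_mem (f := h) h2
      rw [Submodule.map_smul''] at h3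
      have h4 := Submodule.smul_mono le_rfl le_top h3
      simpa using add_mem h1 h4

open Classical in
theorem count_betti (F : MinimalResolution K c) (i : ℕ) (s : Fin r → ℕ) :
    (F.betti i).count s = Fintype.card {j // F.deg i j = s} := by
  rw [betti, Multiset.count_map, Fintype.card_subtype, Finset.card_def, Finset.filter_val]
  simp only [eq_comm]

theorem constantCoeff_eq_zero_of_ne {β : ℕ} {s : Fin β → Fin r → ℕ} {v : Fin β → MvPolynomial σ K}
    {t : Fin r → ℕ} (h : IsHomogeneousVector c s v t) {k : Fin β} (hk : s k ≠ t) :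
    constantCoeff (v k) = 0 := by
  by_contra h0
  exact hk (by simpa using h k 0 (mem_support_iff.mpr h0))

-- Constant terms of the comparison maps give matrices over `K`. Homogeneity kills the entries
-- between different degrees, so the blocks of degree `s` alone satisfy `A * B = 1`, and the rank of
-- `A` bounds one count by the other.
open Classical in
theorem count_betti_le (F G : MinimalResolution K c) (i : ℕ) (s : Fin r → ℕ) :
    (F.betti i).count s ≤ (G.betti i).count s := by
  obtain ⟨φ, ψ, -, hφ, hψ, -, -, -, hm⟩ := comparison_step F G i
  rw [count_betti, count_betti]
  let A : Matrix {j // F.deg i j = s} {k // G.deg i k = s} K :=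
    fun j k => constantCoeff (φ (Pi.single j.1 1) k.1)
  let B : Matrix {k // G.deg i k = s} {j // F.deg i j = s} K :=
    fun k j => constantCoeff (ψ (Pi.single k.1 1) j.1)
  have hAB : A * B = 1 := by
    ext j l
    have h1 := (mem_span_range_X_iff _).mp ((mem_ideal_smul_top_iff _ _).mp
      (hm (Pi.single j.1 1)) l.1)
    rw [Pi.sub_apply, map_sub, sub_eq_zero, map_eq_sum ψ, Finset.sum_apply, map_sum] at h1
    rw [Matrix.mul_apply, Matrix.one_apply]
    have h2 : constantCoeff ((Pi.single j.1 1 : Fin (F.rank i) → MvPolynomial σ K) l.1) =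
        if j = l then 1 else 0 := by
      rw [Pi.single_apply]
      by_cases hjl : j = l
      · simp [hjl]
      · rw [if_neg hjl, if_neg fun h => hjl (Subtype.ext h.symm), map_zero]
    rw [← h2, h1]
    simp only [Pi.smul_apply, smul_eq_mul, map_mul]
    -- Summands with a middle index of degree other than `s` have zero constant term, so the sum
    -- runs over the block only.
    rw [← Finset.sum_filter_of_ne (p := fun k => G.deg i k = s),
      Finset.sum_subtype (p := fun k => G.deg i k = s) _ (fun k => by simp)]
    · intro k _ hk
      by_contra hne
      exact hk (by rw [constantCoeff_eq_zero_of_ne (hφ j.1) (by rwa [j.2]), zero_mul])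
  calc Fintype.card {j // F.deg i j = s} = (A * B).rank := by rw [hAB, Matrix.rank_one]
    _ ≤ A.rank := Matrix.rank_mul_le_left A B
    _ ≤ _ := Matrix.rank_le_card_width A

theorem betti_eq (F G : MinimalResolution K c) (i : ℕ) : F.betti i = G.betti i := by
  classical
  ext s
  exact le_antisymm (count_betti_le F G i s) (count_betti_le G F i s)

end MinimalResolution

end Uniqueness

/-! ### Resolutions as one free module with an endomorphism. -/

/-- A minimal graded free resolution of the image of `θ : R → A`, presented as one free module with
basis `B` and an endomorphism `d`; the basis element `b` has homological degree `hd b` and internal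
degree `deg b`, and the augmentation is lifted to `R`. -/
structure TotalResolution {K : Type*} [Field K] {r : ℕ} {σ : Type} (c : σ → Fin r → ℕ)
    {A : Type*} [CommRing A] [Algebra K A] (θ : MvPolynomial σ K →ₐ[K] A) (B : Type) where
  /-- The homological degrees. -/
  hd : B → ℕ
  /-- The internal degrees. -/
  deg : B → Fin r → ℕ
  /-- The differential. -/
  d : (B →₀ MvPolynomial σ K) →ₗ[MvPolynomial σ K] (B →₀ MvPolynomial σ K)
  /-- The lifted augmentation. -/
  aug : (B →₀ MvPolynomial σ K) →ₗ[MvPolynomial σ K] MvPolynomial σ K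
  d_hd : ∀ b b', d (Finsupp.single b 1) b' ≠ 0 → hd b' + 1 = hd b
  d_deg : ∀ b b', ∀ e ∈ (d (Finsupp.single b 1) b').support,
    Finsupp.weight c e + deg b' = deg b
  d_minimal : ∀ b b', constantCoeff (d (Finsupp.single b 1) b') = 0
  aug_hd : ∀ b, aug (Finsupp.single b 1) ≠ 0 → hd b = 0
  aug_deg : ∀ b, IsWeightedHomogeneous c (aug (Finsupp.single b 1)) (deg b)
  d_d : ∀ v, d (d v) = 0
  aug_d : ∀ v, θ (aug (d v)) = 0
  -- One condition covers every homological degree: `d` vanishes in degree zero and `aug` in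
  -- positive degrees.
  exact : ∀ v, d v = 0 → θ (aug v) = 0 → ∃ w, d w = v
  surj : ∃ w, d w = 0 ∧ θ (aug w) = 1

theorem linearMap_ext_one {R B M : Type*} [CommSemiring R] [AddCommMonoid M] [Module R M]
    {f g : (B →₀ R) →ₗ[R] M} (h : ∀ b, f (Finsupp.single b 1) = g (Finsupp.single b 1)) :
    f = g :=
  Finsupp.lhom_ext' fun b => LinearMap.ext_ring (h b)

/-! ### Assembling the levels of a resolution. -/

section OfMinimal

variable {K : Type*} [Field K] {r : ℕ} {σ : Type} {c : σ → Fin r → ℕ}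

/-- The inclusion of a level in the total free module. -/
noncomputable def levelInclusion (R : Type*) [CommRing R] (n : ℕ → ℕ) (i : ℕ) :
    (Fin (n i) → R) →ₗ[R] ((Σ i, Fin (n i)) →₀ R) :=
  Fintype.linearCombination R (fun j => Finsupp.single ⟨i, j⟩ 1)

/-- The projection of the total free module to a level. -/
def levelProjection (R : Type*) [CommRing R] (n : ℕ → ℕ) (i : ℕ) :
    ((Σ i, Fin (n i)) →₀ R) →ₗ[R] (Fin (n i) → R) where
  toFun v j := v ⟨i, j⟩
  map_add' _ _ := rfl
  map_smul' _ _ := rfl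

section

variable {R : Type*} [CommRing R] {n : ℕ → ℕ}

theorem levelProjection_apply (i : ℕ) (v : (Σ i, Fin (n i)) →₀ R) (j : Fin (n i)) :
    levelProjection R n i v j = v ⟨i, j⟩ := rfl

theorem levelProjection_inclusion (i : ℕ) (v : Fin (n i) → R) :
    levelProjection R n i (levelInclusion R n i v) = v := by
  classical
  funext j
  simp [levelProjection_apply, levelInclusion, Fintype.linearCombination_apply, Finsupp.finsetSum_apply,
    Finsupp.single_apply]

theorem levelProjection_inclusion_of_ne {i i' : ℕ} (h : i' ≠ i) (v : Fin (n i) → R) :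
    levelProjection R n i' (levelInclusion R n i v) = 0 := by
  classical
  funext j
  simp [levelProjection_apply, levelInclusion, Fintype.linearCombination_apply,
    Finsupp.finsetSum_apply, h.symm]

theorem levelProjection_single (i : ℕ) (j : Fin (n i)) :
    levelProjection R n i (Finsupp.single ⟨i, j⟩ 1) = Pi.single j 1 := by
  classical
  funext j'
  simp [levelProjection_apply, Finsupp.single_apply, Pi.single_apply, eq_comm]

theorem levelProjection_single_of_ne {i i' : ℕ} (h : i' ≠ i) (j : Fin (n i)) :
    levelProjection R n i' (Finsupp.single ⟨i, j⟩ 1) = 0 := by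
  classical
  funext j'
  simp [levelProjection_apply, h.symm]

theorem ext_levelProjection {v w : (Σ i, Fin (n i)) →₀ R}
    (h : ∀ i, levelProjection R n i v = levelProjection R n i w) : v = w := by
  ext ⟨i, j⟩
  exact congrFun (h i) j

/-- A finitely supported vector is the finite sum of its levels. Exactness of the total complex
thereby reduces to exactness at each level. -/
theorem mem_of_levels (N : Submodule R ((Σ i, Fin (n i)) →₀ R)) (v : (Σ i, Fin (n i)) →₀ R)
    (h : ∀ i, levelInclusion R n i (levelProjection R n i v) ∈ N) : v ∈ N := by
  classical
  have : v = ∑ i ∈ v.support.image Sigma.fst, levelInclusion R n i (levelProjection R n i v) := by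
    refine ext_levelProjection fun i => ?_
    rw [map_sum]
    by_cases hi : i ∈ v.support.image Sigma.fst
    · rw [Finset.sum_eq_single_of_mem i hi fun i' _ hne =>
        levelProjection_inclusion_of_ne hne.symm _, levelProjection_inclusion]
    · rw [Finset.sum_eq_zero fun i' hi' =>
        levelProjection_inclusion_of_ne (by rintro rfl; exact hi hi') _]
      funext j
      by_contra hne
      exact hi (Finset.mem_image.mpr ⟨⟨i, j⟩, Finsupp.mem_support_iff.mpr hne, rfl⟩)
  rw [this]
  exact Submodule.sum_mem _ fun i _ => h i

end

namespace MinimalResolution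

variable (F : MinimalResolution K c)

/-- The values of the total differential on basis elements. -/
noncomputable def totalDValue :
    (Σ i, Fin (F.rank i)) → ((Σ i, Fin (F.rank i)) →₀ MvPolynomial σ K)
  | ⟨0, _⟩ => 0
  | ⟨i + 1, j⟩ => levelInclusion _ F.rank i (F.d i (Pi.single j 1))

/-- The total differential. -/
noncomputable def totalD :
    ((Σ i, Fin (F.rank i)) →₀ MvPolynomial σ K) →ₗ[MvPolynomial σ K]
      ((Σ i, Fin (F.rank i)) →₀ MvPolynomial σ K) :=
  Finsupp.linearCombination _ F.totalDValue

theorem totalD_single (b) : F.totalD (Finsupp.single b 1) = F.totalDValue b := by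
  simp [totalD]

theorem levelProjection_totalD (i : ℕ) (v) :
    levelProjection _ F.rank i (F.totalD v) = F.d i (levelProjection _ F.rank (i + 1) v) := by
  have : levelProjection _ F.rank i ∘ₗ F.totalD = F.d i ∘ₗ levelProjection _ F.rank (i + 1) := by
    refine linearMap_ext_one fun b => ?_
    rw [LinearMap.comp_apply, LinearMap.comp_apply, totalD_single]
    obtain ⟨_ | k, j⟩ := b
    · rw [levelProjection_single_of_ne (by simp), totalDValue, map_zero, map_zero]
    · rw [totalDValue]
      by_cases h : i = k
      · subst h
        rw [levelProjection_inclusion, levelProjection_single]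
      · rw [levelProjection_inclusion_of_ne h, levelProjection_single_of_ne (by simpa using h),
          map_zero]
  exact LinearMap.congr_fun this v

/-- The homogeneous lifts of the augmentation of the basis elements. -/
noncomputable def augLift (j : Fin (F.rank 0)) : MvPolynomial σ K := (F.aug_homogeneous j).choose

/-- The values of the total augmentation on basis elements. -/
noncomputable def totalAugValue : (Σ i, Fin (F.rank i)) → MvPolynomial σ K
  | ⟨0, j⟩ => F.augLift j
  | ⟨_ + 1, _⟩ => 0

/-- The total augmentation. -/
noncomputable def totalAug :
    ((Σ i, Fin (F.rank i)) →₀ MvPolynomial σ K) →ₗ[MvPolynomial σ K] MvPolynomial σ K :=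
  Finsupp.linearCombination _ F.totalAugValue

theorem totalAug_single (b) : F.totalAug (Finsupp.single b 1) = F.totalAugValue b := by
  simp [totalAug]

theorem mk_totalAug (v) : Ideal.Quotient.mk (toricIdeal K c) (F.totalAug v) =
    F.aug (levelProjection _ F.rank 0 v) := by
  have : (Ideal.Quotient.mkₐ (MvPolynomial σ K) (toricIdeal K c)).toLinearMap ∘ₗ F.totalAug =
      F.aug ∘ₗ levelProjection _ F.rank 0 := by
    refine linearMap_ext_one fun b => ?_
    rw [LinearMap.comp_apply, LinearMap.comp_apply, totalAug_single]
    obtain ⟨_ | k, j⟩ := b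
    · rw [levelProjection_single]
      exact (F.aug_homogeneous j).choose_spec.2.symm
    · rw [levelProjection_single_of_ne (by simp), totalAugValue, map_zero, map_zero]
  exact LinearMap.congr_fun this v

theorem toricMap_totalAug_eq_zero_iff (v) : toricMap K c (F.totalAug v) = 0 ↔
    F.aug (levelProjection _ F.rank 0 v) = 0 := by
  rw [← mk_totalAug, Ideal.Quotient.eq_zero_iff_mem]
  exact Iff.rfl

/-- The total resolution associated with a minimal graded free resolution. -/
noncomputable def total : TotalResolution c (toricMap K c) (Σ i, Fin (F.rank i)) where
  hd b := b.1
  deg b := F.deg b.1 b.2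
  d := F.totalD
  aug := F.totalAug
  d_hd := by
    rintro b ⟨i', j'⟩ h
    rw [totalD_single] at h
    obtain ⟨_ | i, j⟩ := b
    · exact (h rfl).elim
    · by_contra hne
      exact h (congrFun (levelProjection_inclusion_of_ne (i' := i') (by simpa using hne) _) j')
  d_deg := by
    rintro b ⟨i', j'⟩ e he
    rw [totalD_single] at he
    obtain ⟨_ | i, j⟩ := b
    · simp [totalDValue] at he
    · by_cases hne : i' = i
      · subst hne
        have h := congrFun (levelProjection_inclusion i' (F.d i' (Pi.single j 1))) j'
        change (levelInclusion _ F.rank i' (F.d i' (Pi.single j 1))) ⟨i', j'⟩ = _ at h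
        rw [totalDValue, h] at he
        exact F.d_homogeneous i' j j' e he
      · have h := congrFun (levelProjection_inclusion_of_ne hne (F.d i (Pi.single j 1))) j'
        change (levelInclusion _ F.rank i (F.d i (Pi.single j 1))) ⟨i', j'⟩ = _ at h
        rw [totalDValue, h] at he
        simp at he
  d_minimal := by
    rintro b ⟨i', j'⟩
    rw [totalD_single]
    obtain ⟨_ | i, j⟩ := b
    · simp [totalDValue]
    · by_cases hne : i' = i
      · subst hne
        have h := congrFun (levelProjection_inclusion i' (F.d i' (Pi.single j 1))) j'
        change (levelInclusion _ F.rank i' (F.d i' (Pi.single j 1))) ⟨i', j'⟩ = _ at h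
        rw [totalDValue, h]
        exact (mem_span_range_X_iff _).mp
          ((mem_ideal_smul_top_iff _ _).mp (F.minimal i' ⟨_, rfl⟩) j')
      · have h := congrFun (levelProjection_inclusion_of_ne hne (F.d i (Pi.single j 1))) j'
        change (levelInclusion _ F.rank i (F.d i (Pi.single j 1))) ⟨i', j'⟩ = _ at h
        rw [totalDValue, h]
        simp
  aug_hd := by
    rintro ⟨_ | i, j⟩ h
    · rfl
    · rw [totalAug_single] at h
      exact (h rfl).elim
  aug_deg := by
    rintro ⟨_ | i, j⟩
    · rw [totalAug_single]
      exact (F.aug_homogeneous j).choose_spec.1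
    · rw [totalAug_single]
      exact isWeightedHomogeneous_zero _ _ _
  d_d v := by
    refine ext_levelProjection fun i => ?_
    rw [levelProjection_totalD, levelProjection_totalD, map_zero]
    exact (F.exact_succ i _).mpr ⟨_, rfl⟩
  aug_d v := by
    rw [toricMap_totalAug_eq_zero_iff, levelProjection_totalD]
    exact (F.exact_zero _).mpr ⟨_, rfl⟩
  exact v hv hv' := by
    rw [toricMap_totalAug_eq_zero_iff] at hv'
    refine mem_of_levels (LinearMap.range F.totalD) v fun i => ?_
    have : levelProjection _ F.rank i v ∈ LinearMap.range (F.d i) := by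
      cases i with
      | zero => exact (F.exact_zero _).mp hv'
      | succ i =>
        exact (F.exact_succ i _).mp (by rw [← levelProjection_totalD, hv, map_zero])
    obtain ⟨w, hw⟩ := this
    refine ⟨levelInclusion _ F.rank (i + 1) w, ext_levelProjection fun k => ?_⟩
    rw [levelProjection_totalD, ← hw]
    by_cases h : k = i
    · subst h
      rw [levelProjection_inclusion, levelProjection_inclusion]
    · rw [levelProjection_inclusion_of_ne h, levelProjection_inclusion_of_ne (by simpa using h),
        map_zero]
  surj := by
    obtain ⟨u, hu⟩ := F.aug_surjective 1
    refine ⟨levelInclusion _ F.rank 0 u, ext_levelProjection fun i => ?_, ?_⟩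
    · rw [levelProjection_totalD, levelProjection_inclusion_of_ne (by simp), map_zero, map_zero]
    · rw [← sub_eq_zero, ← map_one (toricMap K c), ← map_sub]
      change _ ∈ toricIdeal K c
      rw [← Ideal.Quotient.eq, mk_totalAug, levelProjection_inclusion, hu, map_one]

end MinimalResolution

end OfMinimal

/-! ### Splitting a total resolution into its levels. -/

namespace TotalResolution

variable {K : Type*} [Field K] {r : ℕ} {σ : Type} {c : σ → Fin r → ℕ}
  {A : Type*} [CommRing A] [Algebra K A] {θ : MvPolynomial σ K →ₐ[K] A} {B : Type}
  (T : TotalResolution c θ B)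

/-- The projection to homological degree `i`. -/
noncomputable def proj (i : ℕ) :
    (B →₀ MvPolynomial σ K) →ₗ[MvPolynomial σ K] (B →₀ MvPolynomial σ K) where
  toFun v := v.filter (fun b => T.hd b = i)
  map_add' _ _ := Finsupp.filter_add
  map_smul' _ _ := Finsupp.filter_smul

theorem proj_apply (i : ℕ) (v) (b : B) : T.proj i v b = if T.hd b = i then v b else 0 :=
  Finsupp.filter_apply _ _ _

theorem proj_single_self {i : ℕ} {b : B} (h : T.hd b = i) (x : MvPolynomial σ K) :
    T.proj i (Finsupp.single b x) = Finsupp.single b x :=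
  Finsupp.filter_single_of_pos _ h

theorem proj_single_of_ne {i : ℕ} {b : B} (h : T.hd b ≠ i) (x : MvPolynomial σ K) :
    T.proj i (Finsupp.single b x) = 0 :=
  Finsupp.filter_single_of_neg _ h

theorem proj_d (i : ℕ) (v) : T.proj i (T.d v) = T.d (T.proj (i + 1) v) := by
  have : T.proj i ∘ₗ T.d = T.d ∘ₗ T.proj (i + 1) := by
    refine linearMap_ext_one fun b => ?_
    rw [LinearMap.comp_apply, LinearMap.comp_apply]
    ext1 b'
    rw [proj_apply]
    by_cases h : T.hd b = i + 1
    · rw [T.proj_single_self h]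
      split_ifs with h'
      · rfl
      · by_contra hne
        have := T.d_hd b b' (Ne.symm hne)
        omega
    · rw [T.proj_single_of_ne h, map_zero, Finsupp.zero_apply]
      split_ifs with h'
      · by_contra hne
        have := T.d_hd b b' hne
        omega
      · rfl
  exact LinearMap.congr_fun this v

theorem d_proj_zero (v) : T.d (T.proj 0 v) = 0 := by
  have : T.d ∘ₗ T.proj 0 = 0 := by
    refine linearMap_ext_one fun b => ?_
    rw [LinearMap.comp_apply, LinearMap.zero_apply]
    by_cases h : T.hd b = 0
    · rw [T.proj_single_self h]
      ext1 b'
      by_contra hne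
      have := T.d_hd b b' hne
      omega
    · rw [T.proj_single_of_ne h, map_zero]
  exact LinearMap.congr_fun this v

theorem aug_proj_zero (v) : T.aug (T.proj 0 v) = T.aug v := by
  have : T.aug ∘ₗ T.proj 0 = T.aug := by
    refine linearMap_ext_one fun b => ?_
    rw [LinearMap.comp_apply]
    by_cases h : T.hd b = 0
    · rw [T.proj_single_self h]
    · rw [T.proj_single_of_ne h, map_zero]
      by_contra hne
      exact h (T.aug_hd b (Ne.symm hne))
  exact LinearMap.congr_fun this v

theorem aug_proj_succ (i : ℕ) (v) : T.aug (T.proj (i + 1) v) = 0 := by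
  have : T.aug ∘ₗ T.proj (i + 1) = 0 := by
    refine linearMap_ext_one fun b => ?_
    rw [LinearMap.comp_apply, LinearMap.zero_apply]
    by_cases h : T.hd b = i + 1
    · rw [T.proj_single_self h]
      by_contra hne
      have := T.aug_hd b hne
      omega
    · rw [T.proj_single_of_ne h, map_zero]
  exact LinearMap.congr_fun this v

section ToMinimal

variable [∀ i, Finite {b // T.hd b = i}]

/-- An enumeration of the basis elements of homological degree `i`. -/
noncomputable def levelEquiv (i : ℕ) : Fin (Nat.card {b // T.hd b = i}) ≃ {b // T.hd b = i} :=
  (Finite.equivFin _).symm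

/-- The inclusion of the part of homological degree `i`. -/
noncomputable def incl (i : ℕ) :
    (Fin (Nat.card {b // T.hd b = i}) → MvPolynomial σ K) →ₗ[MvPolynomial σ K]
      (B →₀ MvPolynomial σ K) :=
  Fintype.linearCombination _ (fun j => Finsupp.single (T.levelEquiv i j).1 1)

/-- The coordinates of homological degree `i`. -/
noncomputable def restr (i : ℕ) :
    (B →₀ MvPolynomial σ K) →ₗ[MvPolynomial σ K]
      (Fin (Nat.card {b // T.hd b = i}) → MvPolynomial σ K) where
  toFun v j := v (T.levelEquiv i j).1
  map_add' _ _ := rfl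
  map_smul' _ _ := rfl

theorem restr_apply (i : ℕ) (v) (j) : T.restr i v j = v (T.levelEquiv i j).1 := rfl

theorem incl_single (i : ℕ) (j) :
    T.incl i (Pi.single j 1) = Finsupp.single (T.levelEquiv i j).1 1 := by
  simp [incl, Fintype.linearCombination_apply_single]

theorem incl_restr (i : ℕ) (v) : T.incl i (T.restr i v) = T.proj i v := by
  classical
  have : T.incl i ∘ₗ T.restr i = T.proj i := by
    refine linearMap_ext_one fun b => ?_
    rw [LinearMap.comp_apply]
    by_cases h : T.hd b = i
    · rw [T.proj_single_self h]
      have hb : (T.levelEquiv i ((T.levelEquiv i).symm ⟨b, h⟩)).1 = b := by simp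
      have : T.restr i (Finsupp.single b 1) = Pi.single ((T.levelEquiv i).symm ⟨b, h⟩) 1 := by
        funext j
        rw [restr_apply, Finsupp.single_apply, Pi.single_apply]
        refine if_congr ?_ rfl rfl
        rw [Equiv.eq_symm_apply, Subtype.ext_iff, eq_comm]
      rw [this, incl_single, hb]
    · rw [T.proj_single_of_ne h]
      have : T.restr i (Finsupp.single b 1) = 0 := by
        funext j
        rw [restr_apply, Finsupp.single_apply, if_neg]
        · rfl
        · rintro rfl
          exact h (T.levelEquiv i j).2
      rw [this, map_zero]
  exact LinearMap.congr_fun this v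

theorem restr_incl (i : ℕ) (u) : T.restr i (T.incl i u) = u := by
  classical
  have : T.restr i ∘ₗ T.incl i = LinearMap.id := by
    refine LinearMap.pi_ext' fun j => LinearMap.ext_ring ?_
    simp only [LinearMap.comp_apply, LinearMap.coe_single, incl_single, LinearMap.id_apply]
    funext j'
    rw [restr_apply, Finsupp.single_apply, Pi.single_apply]
    refine if_congr ?_ rfl rfl
    rw [← Subtype.ext_iff, EmbeddingLike.apply_eq_iff_eq, eq_comm]
  exact LinearMap.congr_fun this u

theorem proj_incl (i : ℕ) (u) : T.proj i (T.incl i u) = T.incl i u := by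
  rw [← incl_restr, restr_incl]

theorem restr_d (i : ℕ) (v) : T.restr i (T.d v) =
    T.restr i (T.d (T.incl (i + 1) (T.restr (i + 1) v))) := by
  rw [incl_restr, ← proj_d, ← incl_restr, restr_incl]

end ToMinimal

end TotalResolution

/-- The minimal graded free resolution read off from a total resolution of a toric ring. -/
noncomputable def TotalResolution.toMinimal {K : Type*} [Field K] {r : ℕ} {σ : Type}
    {c : σ → Fin r → ℕ} {B : Type} (T : TotalResolution c (toricMap K c) B)
    [∀ i, Finite {b // T.hd b = i}] : MinimalResolution K c where
  rank i := Nat.card {b // T.hd b = i}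
  deg i j := T.deg (T.levelEquiv i j).1
  d i := T.restr i ∘ₗ T.d ∘ₗ T.incl (i + 1)
  aug := (Ideal.Quotient.mkₐ (MvPolynomial σ K) (toricIdeal K c)).toLinearMap ∘ₗ T.aug ∘ₗ T.incl 0
  d_homogeneous i j k e he := by
    rw [LinearMap.comp_apply, LinearMap.comp_apply, incl_single, restr_apply] at he
    exact T.d_deg _ _ e he
  aug_homogeneous j := by
    refine ⟨_, T.aug_deg (T.levelEquiv 0 j).1, ?_⟩
    rw [LinearMap.comp_apply, LinearMap.comp_apply, incl_single]
    rfl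
  aug_surjective x := by
    obtain ⟨p, rfl⟩ := Ideal.Quotient.mk_surjective x
    obtain ⟨w, -, hw⟩ := T.surj
    refine ⟨T.restr 0 (p • w), ?_⟩
    rw [LinearMap.comp_apply, LinearMap.comp_apply, incl_restr, aug_proj_zero]
    refine Ideal.Quotient.eq.mpr ?_
    change toricMap K c _ = 0
    rw [map_sub, map_smul, smul_eq_mul, map_mul, hw, mul_one, sub_self]
  exact_zero u := by
    rw [LinearMap.comp_apply, LinearMap.comp_apply]
    refine Ideal.Quotient.eq_zero_iff_mem.trans ?_
    constructor
    · intro h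
      -- In homological degree zero being a cycle is automatic, so only the augmentation condition
      -- carries information; in positive degrees the roles are exchanged.
      have hd : T.d (T.incl 0 u) = 0 := by rw [← proj_incl, d_proj_zero]
      obtain ⟨w, hw⟩ := T.exact _ hd h
      refine ⟨T.restr 1 w, ?_⟩
      rw [LinearMap.comp_apply, LinearMap.comp_apply, ← restr_d, hw, restr_incl]
    · rintro ⟨w, rfl⟩
      rw [LinearMap.comp_apply, LinearMap.comp_apply, incl_restr, aug_proj_zero]
      exact T.aug_d _
  exact_succ i u := by
    rw [LinearMap.comp_apply, LinearMap.comp_apply]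
    constructor
    · intro h
      have hd : T.d (T.incl (i + 1) u) = 0 := by
        rw [← proj_incl, ← proj_d, ← incl_restr, h, map_zero]
      have ha : toricMap K c (T.aug (T.incl (i + 1) u)) = 0 := by
        rw [← proj_incl, aug_proj_succ, map_zero]
      obtain ⟨w, hw⟩ := T.exact _ hd ha
      refine ⟨T.restr (i + 2) w, ?_⟩
      rw [LinearMap.comp_apply, LinearMap.comp_apply, ← restr_d, hw, restr_incl]
    · rintro ⟨w, rfl⟩
      rw [LinearMap.comp_apply, LinearMap.comp_apply, ← restr_d, T.d_d, map_zero]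
  minimal i := by
    rintro _ ⟨u, rfl⟩
    rw [map_eq_sum]
    refine Submodule.sum_mem _ fun j _ => Submodule.smul_mem _ _ ?_
    rw [mem_ideal_smul_top_iff]
    intro k
    rw [mem_span_range_X_iff, LinearMap.comp_apply, LinearMap.comp_apply, incl_single, restr_apply]
    exact T.d_minimal _ _

theorem TotalResolution.toMinimal_betti {K : Type*} [Field K] {r : ℕ} {σ : Type}
    {c : σ → Fin r → ℕ} {B : Type} (T : TotalResolution c (toricMap K c) B)
    [∀ i, Finite {b // T.hd b = i}] (i : ℕ) (s : Finset B) (hs : ∀ b, b ∈ s ↔ T.hd b = i) :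
    T.toMinimal.betti i = s.val.map T.deg := by
  have : s = Finset.univ.map ((T.levelEquiv i).toEmbedding.trans (Function.Embedding.subtype _)) := by
    ext b
    rw [hs, Finset.mem_map]
    constructor
    · intro h
      exact ⟨(T.levelEquiv i).symm ⟨b, h⟩, Finset.mem_univ _, by simp⟩
    · rintro ⟨j, -, rfl⟩
      exact (T.levelEquiv i j).2
  rw [this, Finset.map_val, Multiset.map_map]
  rfl

/-! ### Contracting homotopies over the field. -/

/-- Over a field, a section of `f` onto its range exists and extends to all of `W`. -/
theorem exists_generalized_inverse {K V W : Type*} [Field K] [AddCommGroup V] [Module K V]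
    [AddCommGroup W] [Module K W] (f : V →ₗ[K] W) : ∃ g : W →ₗ[K] V, ∀ v, f (g (f v)) = f v := by
  obtain ⟨g, hg⟩ := f.rangeRestrict.exists_rightInverse_of_surjective f.range_rangeRestrict
  obtain ⟨g', hg'⟩ := g.exists_extend
  refine ⟨g', fun v => ?_⟩
  have h1 := LinearMap.congr_fun hg' (f.rangeRestrict v)
  have h2 := congrArg Subtype.val (LinearMap.congr_fun hg (f.rangeRestrict v))
  simp only [LinearMap.comp_apply, Submodule.subtype_apply, LinearMap.codRestrict_apply,
    LinearMap.rangeRestrict, LinearMap.id_apply] at h1 h2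
  rw [h1]
  exact h2

namespace TotalResolution

section Homotopy

variable {K : Type*} [Field K] {r : ℕ} {σ : Type} {c : σ → Fin r → ℕ}
  {A : Type*} [CommRing A] [Algebra K A] {θ : MvPolynomial σ K →ₐ[K] A} {B : Type}
  (T : TotalResolution c θ B)

/-- The sign involution, `(-1) ^ i` in homological degree `i`. -/
noncomputable def sign :
    (B →₀ MvPolynomial σ K) →ₗ[MvPolynomial σ K] (B →₀ MvPolynomial σ K) :=
  Finsupp.linearCombination _ (fun b => (-1 : MvPolynomial σ K) ^ T.hd b • Finsupp.single b 1)

theorem sign_single (b : B) (x : MvPolynomial σ K) :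
    T.sign (Finsupp.single b x) = (-1 : MvPolynomial σ K) ^ T.hd b • Finsupp.single b x := by
  simp [sign, mul_comm]

theorem sign_proj (i : ℕ) (v) :
    T.sign (T.proj i v) = (-1 : MvPolynomial σ K) ^ i • T.proj i v := by
  have : T.sign ∘ₗ T.proj i = (-1 : MvPolynomial σ K) ^ i • T.proj i := by
    refine linearMap_ext_one fun b => ?_
    rw [LinearMap.comp_apply, LinearMap.smul_apply]
    by_cases h : T.hd b = i
    · rw [T.proj_single_self h, sign_single, h]
    · rw [T.proj_single_of_ne h, map_zero, smul_zero]
  exact LinearMap.congr_fun this v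

theorem aug_sign (v) : T.aug (T.sign v) = T.aug v := by
  have : T.aug ∘ₗ T.sign = T.aug := by
    refine linearMap_ext_one fun b => ?_
    rw [LinearMap.comp_apply, sign_single, map_smul]
    by_cases h : T.aug (Finsupp.single b 1) = 0
    · rw [h, smul_zero]
    · rw [T.aug_hd b h, pow_zero, one_smul]
  exact LinearMap.congr_fun this v

theorem d_single_eq_proj {i : ℕ} {b : B} (h : T.hd b = i + 1) (x : MvPolynomial σ K) :
    T.d (Finsupp.single b x) = T.proj i (T.d (Finsupp.single b x)) := by
  rw [proj_d, proj_single_self _ h]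

theorem d_single_eq_zero {b : B} (h : T.hd b = 0) (x : MvPolynomial σ K) :
    T.d (Finsupp.single b x) = 0 := by
  rw [← T.proj_single_self h, d_proj_zero]

theorem sign_d (v) : T.sign (T.d v) = - T.d (T.sign v) := by
  have : T.sign ∘ₗ T.d = - (T.d ∘ₗ T.sign) := by
    refine linearMap_ext_one fun b => ?_
    rw [LinearMap.comp_apply, LinearMap.neg_apply, LinearMap.comp_apply, sign_single, map_smul]
    rcases h : T.hd b with _ | i
    · rw [T.d_single_eq_zero h]
      simp
    · rw [T.d_single_eq_proj h, sign_proj, pow_succ]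
      simp
  exact LinearMap.congr_fun this v

/-- The augmentation as a `K`-linear map to `A`. -/
noncomputable def augK : (B →₀ MvPolynomial σ K) →ₗ[K] A :=
  θ.toLinearMap ∘ₗ T.aug.restrictScalars K

theorem augK_apply (v) : T.augK v = θ (T.aug v) := rfl

/-- Take any generalized inverse of `d` and, on vectors of homological degree `i`, keep only its
component of degree `i + 1`. Since `d` lowers the degree by one, `d s d = d` survives. The result is
odd, and its values have positive degree, where the augmentation vanishes. -/
theorem exists_odd_inverse : ∃ s : (B →₀ MvPolynomial σ K) →ₗ[K] (B →₀ MvPolynomial σ K),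
    (∀ v, T.d (s (T.d v)) = T.d v) ∧ (∀ v, T.sign (s v) = - s (T.sign v)) ∧
      ∀ v, T.aug (s v) = 0 := by
  obtain ⟨s, hs⟩ := exists_generalized_inverse (T.d.restrictScalars K)
  simp only [LinearMap.coe_restrictScalars] at hs
  let s' : (B →₀ MvPolynomial σ K) →ₗ[K] (B →₀ MvPolynomial σ K) :=
    Finsupp.lsum K fun b => (T.proj (T.hd b + 1)).restrictScalars K ∘ₗ s ∘ₗ Finsupp.lsingle b
  have h1 : ∀ b x, s' (Finsupp.single b x) = T.proj (T.hd b + 1) (s (Finsupp.single b x)) := by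
    intro b x
    simp [s']
  have h2 : ∀ i v, s' (T.proj i v) = T.proj (i + 1) (s (T.proj i v)) := by
    intro i v
    induction v using Finsupp.induction_linear with
    | zero => simp
    | add v w hv hw => simp only [map_add, hv, hw]
    | single b x =>
      by_cases h : T.hd b = i
      · rw [T.proj_single_self h, h1, h]
      · rw [T.proj_single_of_ne h]
        simp
  refine ⟨s', fun v => ?_, fun v => ?_, fun v => ?_⟩
  · induction v using Finsupp.induction_linear with
    | zero => simp
    | add v w hv hw => simp only [map_add, hv, hw]
    | single b x =>
      rcases h : T.hd b with _ | i
      · rw [T.d_single_eq_zero h]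
        simp
      · rw [T.d_single_eq_proj h, h2, ← proj_d, ← T.d_single_eq_proj h, hs, ← T.d_single_eq_proj h]
  · induction v using Finsupp.induction_linear with
    | zero => simp
    | add v w hv hw => simp only [map_add, hv, hw, neg_add]
    | single b x =>
      -- Signs are moved from polynomial to field scalars because `s` is only `K`-linear.
      have h4 : ∀ (n : ℕ) (w : B →₀ MvPolynomial σ K), (-1 : MvPolynomial σ K) ^ n • w =
          (-1 : K) ^ n • w := by
        intro n w
        rcases Nat.even_or_odd n with h' | h' <;> simp [h'.neg_one_pow]
      rw [h1, sign_proj, h4, sign_single, h4 _ (Finsupp.single b x), map_smul, h1, pow_succ]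
      simp
  · induction v using Finsupp.induction_linear with
    | zero => simp
    | add v w hv hw => simp only [map_add, hv, hw, add_zero]
    | single b x => rw [h1, aug_proj_succ]

/-- A `K`-linear contracting homotopy of the augmented resolution. -/
theorem exists_homotopy : ∃ (h : (B →₀ MvPolynomial σ K) →ₗ[K] (B →₀ MvPolynomial σ K))
    (g : A →ₗ[K] (B →₀ MvPolynomial σ K)),
    (∀ v, T.d (h v) = v - g (T.augK v) - h (T.d v)) ∧ (∀ v, T.sign (h v) = - h (T.sign v)) ∧
    (∀ a, T.d (g a) = 0) ∧ (∀ a, T.sign (g a) = g a) := by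
  obtain ⟨s, hs, hsign, haug⟩ := T.exists_odd_inverse
  obtain ⟨g₀, hg₀⟩ := exists_generalized_inverse T.augK
  -- Only degree zero matters to the augmentation, so projecting keeps the generalized inverse while
  -- making its values sign-invariant cycles.
  let g : A →ₗ[K] (B →₀ MvPolynomial σ K) := (T.proj 0).restrictScalars K ∘ₗ g₀
  have hg : ∀ a, g a = T.proj 0 (g₀ a) := fun a => rfl
  have hgd : ∀ a, T.d (g a) = 0 := fun a => T.d_proj_zero _
  have hgs : ∀ a, T.sign (g a) = g a := fun a => by rw [hg, sign_proj]; simp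
  have hga : ∀ v, T.augK (g (T.augK v)) = T.augK v := fun v => by
    conv_rhs => rw [← hg₀]
    rw [hg, augK_apply, aug_proj_zero, ← augK_apply]
  have had : ∀ v, T.augK (T.d v) = 0 := fun v => T.aug_d v
  have has : ∀ v, T.augK (s v) = 0 := fun v => by rw [augK_apply, haug, map_zero]
  have haσ : ∀ v, T.augK (T.sign v) = T.augK v := fun v => by
    rw [augK_apply, aug_sign, augK_apply]
  let dK := T.d.restrictScalars K
  have hdK : ∀ v, dK v = T.d v := fun v => rfl
  -- With ε the augmentation, h v = s(v - s d v - g ε v). The argument is a cycle killed by ε, hence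
  -- a boundary, on which d s is the identity; and h d = s d because d d = 0 and ε d = 0.
  refine ⟨s - s ∘ₗ s ∘ₗ dK - s ∘ₗ g ∘ₗ T.augK, g, fun v => ?_, fun v => ?_, hgd, hgs⟩
  · have : ∃ w, T.d w = v - s (T.d v) - g (T.augK v) := by
      refine T.exact _ ?_ ?_
      · rw [map_sub, map_sub, hs, hgd]
        simp
      · rw [← augK_apply, map_sub, map_sub, has, hga]
        simp
    obtain ⟨w, hw⟩ := this
    have h1 := hs w
    rw [hw, map_sub, map_sub] at h1
    simp only [LinearMap.sub_apply, LinearMap.comp_apply, hdK, T.d_d, had, map_zero, sub_zero]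
    rw [map_sub, map_sub] at h1 ⊢
    rw [h1]
    abel
  · simp only [LinearMap.sub_apply, LinearMap.comp_apply, hdK, map_sub, hsign, sign_d, haσ, hgs,
      map_neg]
    have h2 : T.d (T.sign v) = - T.sign (T.d v) := by rw [sign_d, neg_neg]
    rw [h2]
    simp only [map_neg]
    abel

end Homotopy

end TotalResolution

/-! ### The product semigroup ring as a tensor product. -/

section Generators

variable {K : Type*} [Field K] {r : ℕ} {σ τ : Type}

/-- The degrees of the generators of the product semigroup `S₁ × S₂`. -/
def prodGenerators (a : σ → Fin r → ℕ) (b : τ → Fin r → ℕ) :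
    σ ⊕ τ → (Fin r → ℕ) × (Fin r → ℕ) :=
  Sum.elim (fun j => (a j, 0)) (fun j => (0, b j))

/-- The parametrization of `K[S₁ × S₂] = K[S₁] ⊗ K[S₂]`. -/
noncomputable def prodToricMap (K : Type*) [Field K] (a : σ → Fin r → ℕ) (b : τ → Fin r → ℕ) :
    MvPolynomial (σ ⊕ τ) K →ₐ[K] AddMonoidAlgebra K ((Fin r → ℕ) × (Fin r → ℕ)) :=
  aeval (fun x => AddMonoidAlgebra.single (prodGenerators a b x) (1 : K))

variable {a : σ → Fin r → ℕ} {b : τ → Fin r → ℕ}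

theorem weight_mapDomain {M υ υ' : Type*} [AddCommMonoid M] (f : υ → υ') (c : υ' → M) (e : υ →₀ ℕ) :
    Finsupp.weight c (Finsupp.mapDomain f e) = Finsupp.weight (c ∘ f) e := by
  rw [Finsupp.weight_apply, Finsupp.weight_apply, Finsupp.sum_mapDomain_index]
  · rfl
  · simp
  · intros; rw [add_smul]

theorem weight_prod_inl (e : σ →₀ ℕ) :
    Finsupp.weight (prodGenerators a b ∘ Sum.inl) e = (Finsupp.weight a e, 0) := by
  rw [Finsupp.weight_apply, Finsupp.weight_apply]
  simp [Finsupp.sum, prodGenerators, Prod.ext_iff, Prod.fst_sum, Prod.snd_sum]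

theorem weight_prod_inr (e : τ →₀ ℕ) :
    Finsupp.weight (prodGenerators a b ∘ Sum.inr) e = (0, Finsupp.weight b e) := by
  rw [Finsupp.weight_apply, Finsupp.weight_apply]
  simp [Finsupp.sum, prodGenerators, Prod.ext_iff, Prod.fst_sum, Prod.snd_sum]

theorem prodToricMap_mul (p : MvPolynomial σ K) (q : MvPolynomial τ K) :
    prodToricMap K a b (rename Sum.inl p * rename Sum.inr q) =
      AddMonoidAlgebra.tensorEquiv K (toricMap K a p ⊗ₜ toricMap K b q) := by
  induction p using MvPolynomial.induction_on' with
  | add p p' hp hp' => simp only [map_add, add_mul, TensorProduct.add_tmul, hp, hp']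
  | monomial e x =>
    induction q using MvPolynomial.induction_on' with
    | add q q' hq hq' => simp only [map_add, mul_add, TensorProduct.tmul_add, hq, hq']
    | monomial e' x' =>
      rw [toricMap_monomial, toricMap_monomial, AddMonoidAlgebra.tensorEquiv_single_tmul_single,
        rename_monomial, rename_monomial, map_mul, prodToricMap, aeval_single_monomial,
        aeval_single_monomial, weight_mapDomain, weight_mapDomain, weight_prod_inl,
        weight_prod_inr, AddMonoidAlgebra.single_mul_single]
      simp

theorem tensorEquivSum_tmul (p : MvPolynomial σ K) (q : MvPolynomial τ K) :
    tensorEquivSum K σ τ K (p ⊗ₜ q) = rename Sum.inl p * rename Sum.inr q := by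
  have h1 : ∀ p : MvPolynomial σ K, tensorEquivSum K σ τ K (p ⊗ₜ 1) = rename Sum.inl p := by
    intro p
    have : (tensorEquivSum K σ τ K).toAlgHom.comp Algebra.TensorProduct.includeLeft =
        rename Sum.inl := by
      ext x
      simp
    exact DFunLike.congr_fun this p
  have h2 : ∀ q : MvPolynomial τ K, tensorEquivSum K σ τ K (1 ⊗ₜ q) = rename Sum.inr q := by
    intro q
    have : (tensorEquivSum K σ τ K).toAlgHom.comp Algebra.TensorProduct.includeRight =
        rename Sum.inr := by
      ext x
      simp
    exact DFunLike.congr_fun this q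
  rw [← h1, ← h2, ← map_mul, Algebra.TensorProduct.tmul_mul_tmul, one_mul, mul_one]

end Generators

/-! ### Exterior tensor products of free modules. -/

section FreeTensor

variable (K : Type*) [Field K] (σ τ B₁ B₂ : Type)

/-- The exterior tensor product of free modules over two polynomial rings. -/
noncomputable def freeTensor :
    (B₁ →₀ MvPolynomial σ K) ⊗[K] (B₂ →₀ MvPolynomial τ K) ≃ₗ[K]
      (B₁ × B₂ →₀ MvPolynomial (σ ⊕ τ) K) :=
  finsuppTensorFinsupp K K _ _ B₁ B₂ ≪≫ₗ
    Finsupp.mapRange.linearEquiv (tensorEquivSum K σ τ K).toLinearEquiv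

variable {K σ τ B₁ B₂}

theorem freeTensor_apply (v : B₁ →₀ MvPolynomial σ K) (w : B₂ →₀ MvPolynomial τ K) (x : B₁ × B₂) :
    freeTensor K σ τ B₁ B₂ (v ⊗ₜ w) x = rename Sum.inl (v x.1) * rename Sum.inr (w x.2) := by
  obtain ⟨x, y⟩ := x
  simp [freeTensor, tensorEquivSum_tmul]

theorem freeTensor_single (x : B₁) (y : B₂) (p : MvPolynomial σ K) (q : MvPolynomial τ K) :
    freeTensor K σ τ B₁ B₂ (Finsupp.single x p ⊗ₜ Finsupp.single y q) =
      (rename Sum.inl p * rename Sum.inr q) • Finsupp.single (x, y) 1 := by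
  simp [freeTensor, tensorEquivSum_tmul]

theorem freeTensor_smul (p : MvPolynomial σ K) (q : MvPolynomial τ K)
    (v : B₁ →₀ MvPolynomial σ K) (w : B₂ →₀ MvPolynomial τ K) :
    freeTensor K σ τ B₁ B₂ ((p • v) ⊗ₜ (q • w)) =
      (rename Sum.inl p * rename Sum.inr q) • freeTensor K σ τ B₁ B₂ (v ⊗ₜ w) := by
  ext1 x
  rw [freeTensor_apply, Finsupp.smul_apply, Finsupp.smul_apply, Finsupp.smul_apply,
    freeTensor_apply]
  simp only [smul_eq_mul, map_mul]
  ring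

theorem tensor_hom_ext {M : Type*} [AddCommGroup M] [Module K M]
    {f g : (B₁ →₀ MvPolynomial σ K) ⊗[K] (B₂ →₀ MvPolynomial τ K) →ₗ[K] M}
    (h : ∀ x p y q, f (Finsupp.single x p ⊗ₜ Finsupp.single y q) =
      g (Finsupp.single x p ⊗ₜ Finsupp.single y q)) : f = g := by
  refine TensorProduct.ext' fun v w => ?_
  induction v using Finsupp.induction_linear with
  | zero => simp
  | add v v' hv hv' => simp only [TensorProduct.add_tmul, map_add, hv, hv']
  | single x p =>
    induction w using Finsupp.induction_linear with
    | zero => simp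
    | add w w' hw hw' => simp only [TensorProduct.tmul_add, map_add, hw, hw']
    | single y q => exact h x p y q

end FreeTensor

/-! ### The tensor product of two resolutions. -/

namespace TotalResolution

variable {K : Type*} [Field K] {r : ℕ} {σ τ : Type} {a : σ → Fin r → ℕ} {b : τ → Fin r → ℕ}
  {B₁ B₂ : Type} (T₁ : TotalResolution a (toricMap K a) B₁)
  (T₂ : TotalResolution b (toricMap K b) B₂)

/-- The differential of the tensor product over `K`. -/
noncomputable def tensorDK :
    (B₁ →₀ MvPolynomial σ K) ⊗[K] (B₂ →₀ MvPolynomial τ K) →ₗ[K]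
      (B₁ →₀ MvPolynomial σ K) ⊗[K] (B₂ →₀ MvPolynomial τ K) :=
  TensorProduct.map (T₁.d.restrictScalars K) LinearMap.id +
    TensorProduct.map (T₁.sign.restrictScalars K) (T₂.d.restrictScalars K)

theorem tensorDK_tmul (v : B₁ →₀ MvPolynomial σ K) (w : B₂ →₀ MvPolynomial τ K) :
    tensorDK T₁ T₂ (v ⊗ₜ w) = T₁.d v ⊗ₜ w + T₁.sign v ⊗ₜ T₂.d w := rfl

/-- The differential of the tensor product over the polynomial ring. -/
noncomputable def tensorD :
    (B₁ × B₂ →₀ MvPolynomial (σ ⊕ τ) K) →ₗ[MvPolynomial (σ ⊕ τ) K]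
      (B₁ × B₂ →₀ MvPolynomial (σ ⊕ τ) K) :=
  Finsupp.linearCombination _ fun x => freeTensor K σ τ B₁ B₂
    (tensorDK T₁ T₂ (Finsupp.single x.1 1 ⊗ₜ Finsupp.single x.2 1))

theorem tensorD_single (x : B₁ × B₂) : tensorD T₁ T₂ (Finsupp.single x 1) =
    freeTensor K σ τ B₁ B₂ (tensorDK T₁ T₂ (Finsupp.single x.1 1 ⊗ₜ Finsupp.single x.2 1)) := by
  simp [tensorD]

theorem single_eq_smul_one {R B : Type*} [CommSemiring R] (x : B) (p : R) :
    Finsupp.single x p = p • Finsupp.single x 1 := by simp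

/-- This moves questions about the polynomial-linear differential to the `K`-linear one, where they
can be checked on pure tensors. -/
theorem tensorD_freeTensor (z) : tensorD T₁ T₂ (freeTensor K σ τ B₁ B₂ z) =
    freeTensor K σ τ B₁ B₂ (tensorDK T₁ T₂ z) := by
  have : (tensorD T₁ T₂).restrictScalars K ∘ₗ (freeTensor K σ τ B₁ B₂).toLinearMap =
      (freeTensor K σ τ B₁ B₂).toLinearMap ∘ₗ tensorDK T₁ T₂ := by
    refine tensor_hom_ext fun x p y q => ?_
    simp only [LinearMap.comp_apply, LinearEquiv.coe_coe, LinearMap.coe_restrictScalars]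
    rw [freeTensor_single, map_smul, tensorD_single, single_eq_smul_one x p,
      single_eq_smul_one y q]
    simp only [tensorDK_tmul, map_smul, map_add, freeTensor_smul, smul_add]
  exact LinearMap.congr_fun this z

/-- The augmentation of the tensor product. -/
noncomputable def tensorAug :
    (B₁ × B₂ →₀ MvPolynomial (σ ⊕ τ) K) →ₗ[MvPolynomial (σ ⊕ τ) K] MvPolynomial (σ ⊕ τ) K :=
  Finsupp.linearCombination _ fun x =>
    rename Sum.inl (T₁.aug (Finsupp.single x.1 1)) * rename Sum.inr (T₂.aug (Finsupp.single x.2 1))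

theorem tensorAug_single (x : B₁ × B₂) : tensorAug T₁ T₂ (Finsupp.single x 1) =
    rename Sum.inl (T₁.aug (Finsupp.single x.1 1)) *
      rename Sum.inr (T₂.aug (Finsupp.single x.2 1)) := by
  simp [tensorAug]

theorem prodToricMap_tensorAug (z) :
    prodToricMap K a b (tensorAug T₁ T₂ (freeTensor K σ τ B₁ B₂ z)) =
      AddMonoidAlgebra.tensorEquiv K (TensorProduct.map T₁.augK T₂.augK z) := by
  have : (prodToricMap K a b).toLinearMap ∘ₗ (tensorAug T₁ T₂).restrictScalars K ∘ₗ
        (freeTensor K σ τ B₁ B₂).toLinearMap =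
      (AddMonoidAlgebra.tensorEquiv K).toLinearMap ∘ₗ TensorProduct.map T₁.augK T₂.augK := by
    refine tensor_hom_ext fun x p y q => ?_
    simp only [LinearMap.comp_apply, LinearEquiv.coe_coe, LinearMap.coe_restrictScalars,
      AlgHom.toLinearMap_apply, TensorProduct.map_tmul, augK_apply]
    rw [freeTensor_single, map_smul (tensorAug T₁ T₂), tensorAug_single, single_eq_smul_one x p,
      single_eq_smul_one y q, ← prodToricMap_mul, map_smul T₁.aug, map_smul T₂.aug]
    simp only [smul_eq_mul, map_mul]
    ring
  exact LinearMap.congr_fun this z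

/-- The mixed terms cancel because the sign involution anticommutes with the first differential. -/
theorem tensorDK_tensorDK (z) : tensorDK T₁ T₂ (tensorDK T₁ T₂ z) = 0 := by
  have : tensorDK T₁ T₂ ∘ₗ tensorDK T₁ T₂ = 0 := by
    refine TensorProduct.ext' fun v w => ?_
    simp only [LinearMap.comp_apply, tensorDK_tmul, map_add, T₁.d_d, T₂.d_d, T₁.sign_d,
      TensorProduct.zero_tmul, TensorProduct.tmul_zero, TensorProduct.neg_tmul,
      LinearMap.zero_apply]
    abel
  exact LinearMap.congr_fun this z

theorem augK_tensorDK (z) : TensorProduct.map T₁.augK T₂.augK (tensorDK T₁ T₂ z) = 0 := by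
  have : TensorProduct.map T₁.augK T₂.augK ∘ₗ tensorDK T₁ T₂ = 0 := by
    refine TensorProduct.ext' fun v w => ?_
    simp only [LinearMap.comp_apply, tensorDK_tmul, map_add, TensorProduct.map_tmul,
      augK_apply, T₁.aug_d, T₂.aug_d, TensorProduct.zero_tmul, TensorProduct.tmul_zero, add_zero,
      LinearMap.zero_apply]
  exact LinearMap.congr_fun this z

/-- Künneth by an explicit homotopy: with ε, ε' the augmentations, H = h ⊗ 1 + gε ⊗ h' satisfies DH
+ HD = 1 - gε ⊗ g'ε'. On a cycle killed by ε ⊗ ε' this reads DH z = z. -/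
theorem exists_tensorDK_eq {z} (hz : tensorDK T₁ T₂ z = 0)
    (hz' : TensorProduct.map T₁.augK T₂.augK z = 0) : ∃ w, tensorDK T₁ T₂ w = z := by
  obtain ⟨h, g, hh, hs, hgd, hgs⟩ := T₁.exists_homotopy
  obtain ⟨h', g', hh', -, -, -⟩ := T₂.exists_homotopy
  let H : (B₁ →₀ MvPolynomial σ K) ⊗[K] (B₂ →₀ MvPolynomial τ K) →ₗ[K]
      (B₁ →₀ MvPolynomial σ K) ⊗[K] (B₂ →₀ MvPolynomial τ K) := TensorProduct.map h LinearMap.id + TensorProduct.map (g ∘ₗ T₁.augK) h'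
  have hH : ∀ v w, H (v ⊗ₜ w) = h v ⊗ₜ w + g (T₁.augK v) ⊗ₜ h' w := fun v w => rfl
  have had : ∀ v, T₁.augK (T₁.d v) = 0 := fun v => T₁.aug_d v
  have haσ : ∀ v, T₁.augK (T₁.sign v) = T₁.augK v := fun v => by
    rw [augK_apply, aug_sign, augK_apply]
  let P : (B₁ →₀ MvPolynomial σ K) ⊗[K] (B₂ →₀ MvPolynomial τ K) →ₗ[K]
      (B₁ →₀ MvPolynomial σ K) ⊗[K] (B₂ →₀ MvPolynomial τ K) :=
    TensorProduct.map g g' ∘ₗ TensorProduct.map T₁.augK T₂.augK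
  have hP : ∀ v w, P (v ⊗ₜ w) = g (T₁.augK v) ⊗ₜ g' (T₂.augK w) := fun v w => rfl
  have key : tensorDK T₁ T₂ ∘ₗ H + H ∘ₗ tensorDK T₁ T₂ + P = LinearMap.id := by
    refine TensorProduct.ext' fun v w => ?_
    simp only [LinearMap.comp_apply, LinearMap.add_apply, hH, tensorDK_tmul,
      map_add, hh, hh', hs, hgd, hgs, had, haσ, hP, map_zero,
      TensorProduct.zero_tmul, TensorProduct.neg_tmul, TensorProduct.sub_tmul,
      TensorProduct.tmul_sub, LinearMap.id_apply]
    abel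
  refine ⟨H z, ?_⟩
  have := LinearMap.congr_fun key z
  simpa [hz, hz', P] using this

theorem tensorD_single_apply (x y : B₁ × B₂) : tensorD T₁ T₂ (Finsupp.single x 1) y =
    rename Sum.inl (T₁.d (Finsupp.single x.1 1) y.1) *
        rename Sum.inr ((Finsupp.single x.2 1 : B₂ →₀ MvPolynomial τ K) y.2) +
      rename Sum.inl ((-1) ^ T₁.hd x.1 * (Finsupp.single x.1 1 : B₁ →₀ MvPolynomial σ K) y.1) *
        rename Sum.inr (T₂.d (Finsupp.single x.2 1) y.2) := by
  rw [tensorD_single, tensorDK_tmul, map_add, Finsupp.add_apply, freeTensor_apply,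
    freeTensor_apply, sign_single]
  rfl

theorem weight_elim_inl (e : σ →₀ ℕ) :
    Finsupp.weight (Sum.elim a b) (Finsupp.mapDomain Sum.inl e) = Finsupp.weight a e := by
  rw [weight_mapDomain, Sum.elim_comp_inl]

theorem weight_elim_inr (e : τ →₀ ℕ) :
    Finsupp.weight (Sum.elim a b) (Finsupp.mapDomain Sum.inr e) = Finsupp.weight b e := by
  rw [weight_mapDomain, Sum.elim_comp_inr]

theorem isWeightedHomogeneous_rename_inl {p : MvPolynomial σ K} {t : Fin r → ℕ}
    (h : IsWeightedHomogeneous a p t) :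
    IsWeightedHomogeneous (Sum.elim a b) (rename Sum.inl p) t := by
  intro e he
  obtain ⟨u, rfl, hu⟩ := coeff_rename_ne_zero _ _ _ he
  rw [weight_elim_inl, h hu]

theorem isWeightedHomogeneous_rename_inr {p : MvPolynomial τ K} {t : Fin r → ℕ}
    (h : IsWeightedHomogeneous b p t) :
    IsWeightedHomogeneous (Sum.elim a b) (rename Sum.inr p) t := by
  intro e he
  obtain ⟨u, rfl, hu⟩ := coeff_rename_ne_zero _ _ _ he
  rw [weight_elim_inr, h hu]

theorem ne_or_ne_of_add_ne_zero {M : Type*} [AddZeroClass M] {x y : M} (h : x + y ≠ 0) :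
    x ≠ 0 ∨ y ≠ 0 := by
  by_contra! h0
  exact h (by rw [h0.1, h0.2, add_zero])

/-- The tensor product of total resolutions of `K[S₁]` and `K[S₂]` resolves `K[S₁ × S₂]`. -/
noncomputable def tensor :
    TotalResolution (Sum.elim a b) (prodToricMap K a b) (B₁ × B₂) where
  hd x := T₁.hd x.1 + T₂.hd x.2
  deg x := T₁.deg x.1 + T₂.deg x.2
  d := tensorD T₁ T₂
  aug := tensorAug T₁ T₂
  d_hd x y h := by
    classical
    rw [tensorD_single_apply] at h
    rcases ne_or_ne_of_add_ne_zero h with h | h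
    · have h1 : T₁.d (Finsupp.single x.1 1) y.1 ≠ 0 := by
        intro h0
        simp [h0] at h
      have h2 : x.2 = y.2 := by
        by_contra h0
        simp [h0] at h
      have := T₁.d_hd _ _ h1
      rw [h2]
      omega
    · have h1 : T₂.d (Finsupp.single x.2 1) y.2 ≠ 0 := by
        intro h0
        simp [h0] at h
      have h2 : x.1 = y.1 := by
        by_contra h0
        simp [h0] at h
      have := T₂.d_hd _ _ h1
      rw [h2]
      omega
  d_deg x y e he := by
    classical
    rw [tensorD_single_apply] at he
    rcases Finset.mem_union.mp (support_add he) with h | h <;>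
    obtain ⟨e₁, h₁, e₂, h₂, rfl⟩ := Finset.mem_add.mp (support_mul _ _ h)
    · obtain ⟨u, rfl, hu⟩ := coeff_rename_ne_zero _ _ _ (mem_support_iff.mp h₁)
      have h2 : x.2 = y.2 := by
        by_contra h0
        simp [h0] at h₂
      rw [Finsupp.single_apply, if_pos h2, map_one] at h₂
      -- The factor from the other resolution is the constant 1, so it contributes no exponent.
      have h3 : e₂ = 0 := by
        by_contra h0
        exact mem_support_iff.mp h₂ (by rw [coeff_one, if_neg (Ne.symm h0)])
      rw [h3, add_zero, weight_elim_inl, ← add_assoc, T₁.d_deg _ _ u (mem_support_iff.mpr hu), h2]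
    · obtain ⟨u, rfl, hu⟩ := coeff_rename_ne_zero _ _ _ (mem_support_iff.mp h₂)
      have h2 : x.1 = y.1 := by
        by_contra h0
        simp [h0] at h₁
      have h3 : e₁ = 0 := by
        by_contra h0
        refine mem_support_iff.mp h₁ ?_
        rw [Finsupp.single_apply, if_pos h2]
        rcases Nat.even_or_odd (T₁.hd x.1) with h' | h' <;>
          simp [h'.neg_one_pow, coeff_one, Ne.symm h0]
      rw [h3, zero_add, weight_elim_inr, add_left_comm, T₂.d_deg _ _ u (mem_support_iff.mpr hu),
        h2]
  d_minimal x y := by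
    rw [tensorD_single_apply]
    simp [constantCoeff_rename, T₁.d_minimal, T₂.d_minimal]
  aug_hd x h := by
    rw [tensorAug_single] at h
    rw [T₁.aug_hd x.1 (by rintro h0; simp [h0] at h), T₂.aug_hd x.2 (by rintro h0; simp [h0] at h)]
  aug_deg x := by
    rw [tensorAug_single]
    exact (isWeightedHomogeneous_rename_inl (T₁.aug_deg _)).mul
      (isWeightedHomogeneous_rename_inr (T₂.aug_deg _))
  d_d v := by
    obtain ⟨z, rfl⟩ := (freeTensor K σ τ B₁ B₂).surjective v
    rw [tensorD_freeTensor, tensorD_freeTensor, tensorDK_tensorDK, map_zero]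
  aug_d v := by
    obtain ⟨z, rfl⟩ := (freeTensor K σ τ B₁ B₂).surjective v
    rw [tensorD_freeTensor, prodToricMap_tensorAug, augK_tensorDK, map_zero]
  exact v hv hv' := by
    obtain ⟨z, rfl⟩ := (freeTensor K σ τ B₁ B₂).surjective v
    rw [tensorD_freeTensor, LinearEquiv.map_eq_zero_iff] at hv
    rw [prodToricMap_tensorAug, LinearEquiv.map_eq_zero_iff] at hv'
    obtain ⟨w, rfl⟩ := exists_tensorDK_eq T₁ T₂ hv hv'
    exact ⟨_, tensorD_freeTensor T₁ T₂ w⟩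
  surj := by
    obtain ⟨w₁, h₁, h₁'⟩ := T₁.surj
    obtain ⟨w₂, h₂, h₂'⟩ := T₂.surj
    refine ⟨freeTensor K σ τ B₁ B₂ (w₁ ⊗ₜ w₂), ?_, ?_⟩
    · rw [tensorD_freeTensor, tensorDK_tmul, h₁, h₂]
      simp
    · rw [prodToricMap_tensorAug, TensorProduct.map_tmul, augK_apply, augK_apply, h₁', h₂',
        AddMonoidAlgebra.one_def, AddMonoidAlgebra.tensorEquiv_single_tmul_single, mul_one]
      rfl

end TotalResolution

/-! ### The mapping cone of multiplication by ρ. -/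

namespace TotalResolution

section Cone

variable {K : Type*} [Field K] {r : ℕ} {σ : Type} {c : σ → Fin r → ℕ}
  {A : Type*} [CommRing A] [Algebra K A] {θ : MvPolynomial σ K →ₐ[K] A} {B : Type}
  (T : TotalResolution c θ B)

/-- The differential of the mapping cone of the multiplication by `ρ`. -/
noncomputable def coneDProd (ρ : MvPolynomial σ K) :
    (B →₀ MvPolynomial σ K) × (B →₀ MvPolynomial σ K) →ₗ[MvPolynomial σ K]
      (B →₀ MvPolynomial σ K) × (B →₀ MvPolynomial σ K) :=
  (T.d ∘ₗ LinearMap.fst _ _ _ + ρ • LinearMap.snd _ _ _).prod (-(T.d ∘ₗ LinearMap.snd _ _ _))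

theorem coneDProd_apply (ρ : MvPolynomial σ K) (x) :
    T.coneDProd ρ x = (T.d x.1 + ρ • x.2, - T.d x.2) := rfl

/-- The coordinates of the mapping cone. -/
noncomputable def coneEquiv (R : Type*) [CommRing R] (B : Type) :
    (B ⊕ B →₀ R) ≃ₗ[R] (B →₀ R) × (B →₀ R) :=
  Finsupp.sumFinsuppLEquivProdFinsupp R

theorem coneEquiv_inl {R : Type*} [CommRing R] (b : B) :
    coneEquiv R B (Finsupp.single (Sum.inl b) 1) = (Finsupp.single b 1, 0) := by
  classical
  ext b' <;> simp [coneEquiv, Finsupp.single_apply]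

theorem coneEquiv_inr {R : Type*} [CommRing R] (b : B) :
    coneEquiv R B (Finsupp.single (Sum.inr b) 1) = (0, Finsupp.single b 1) := by
  classical
  ext b' <;> simp [coneEquiv, Finsupp.single_apply]

theorem coneEquiv_symm_inl {R : Type*} [CommRing R] (x : (B →₀ R) × (B →₀ R)) (b : B) :
    (coneEquiv R B).symm x (Sum.inl b) = x.1 b := rfl

theorem coneEquiv_symm_inr {R : Type*} [CommRing R] (x : (B →₀ R) × (B →₀ R)) (b : B) :
    (coneEquiv R B).symm x (Sum.inr b) = x.2 b := rfl

/-- The differential of the mapping cone, on the free module with basis `B ⊕ B`. -/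
noncomputable def coneD (ρ : MvPolynomial σ K) :
    (B ⊕ B →₀ MvPolynomial σ K) →ₗ[MvPolynomial σ K] (B ⊕ B →₀ MvPolynomial σ K) :=
  (coneEquiv _ B).symm.toLinearMap ∘ₗ T.coneDProd ρ ∘ₗ (coneEquiv _ B).toLinearMap

theorem coneD_apply (ρ : MvPolynomial σ K) (v) :
    T.coneD ρ v = (coneEquiv _ B).symm (T.coneDProd ρ (coneEquiv _ B v)) := rfl

/-- The augmentation of the mapping cone. -/
noncomputable def coneAug :
    (B ⊕ B →₀ MvPolynomial σ K) →ₗ[MvPolynomial σ K] MvPolynomial σ K :=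
  T.aug ∘ₗ LinearMap.fst _ _ _ ∘ₗ (coneEquiv _ B).toLinearMap

theorem coneAug_apply (v) : T.coneAug v = T.aug (coneEquiv _ B v).1 := rfl

/-- Augmenting the first equation gives θ(ρ) θ(aug y) = 0; in a domain θ(aug y) = 0, so y = d y'.
Then x + ρ y' is a cycle whose augmentation lies in ker θ', that is, equals q ρ modulo ker θ.
Subtracting q ρ times a cycle over 1 leaves a boundary. -/
theorem cone_exact [IsDomain A] {A' : Type*} [CommRing A'] [Algebra K A']
    {θ' : MvPolynomial σ K →ₐ[K] A'} {ρ : MvPolynomial σ K} (hρ : θ ρ ≠ 0)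
    (hker : ∀ p, θ' p = 0 → ∃ q, θ (p - q * ρ) = 0) (hθρ : θ' ρ = 0)
    {x y : B →₀ MvPolynomial σ K} (hx : T.d x + ρ • y = 0) (hy : T.d y = 0)
    (hx' : θ' (T.aug x) = 0) : ∃ u v, T.d u + ρ • v = x ∧ - T.d v = y := by
  have h1 : θ (T.aug y) = 0 := by
    have h2 := T.aug_d x
    rw [eq_neg_of_add_eq_zero_left hx, map_neg, map_smul, smul_eq_mul, map_neg, map_mul,
      neg_eq_zero] at h2
    exact (mul_eq_zero.mp h2).resolve_left hρ
  obtain ⟨y', rfl⟩ := T.exact y hy h1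
  obtain ⟨q, hq⟩ := hker (T.aug (x + ρ • y')) (by simp [hx', hθρ])
  obtain ⟨w, hw, hw'⟩ := T.surj
  obtain ⟨z, hz⟩ := T.exact (x + ρ • y' - (q * ρ) • w)
    (by rw [map_sub, map_add, map_smul, map_smul, hw, smul_zero, sub_zero, hx])
    (by
      rw [map_sub] at hq
      rw [map_sub, map_smul (T.aug) (q * ρ), map_sub, smul_eq_mul, map_mul _ (q * ρ), hw', mul_one,
        hq])
  refine ⟨z, q • w - y', ?_, ?_⟩
  · rw [hz, smul_sub, smul_smul, mul_comm q]
    abel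
  · rw [map_sub, map_smul, hw, smul_zero, zero_sub, neg_neg]

/-- The mapping cone of the multiplication by a homogeneous nonzerodivisor. -/
noncomputable def cone [IsDomain A] {A' : Type*} [CommRing A'] [Algebra K A']
    (θ' : MvPolynomial σ K →ₐ[K] A') (ρ : MvPolynomial σ K) (α : Fin r → ℕ)
    (hρα : IsWeightedHomogeneous c ρ α) (hρ0 : constantCoeff ρ = 0) (hρ : θ ρ ≠ 0)
    (hker : ∀ p, θ' p = 0 → ∃ q, θ (p - q * ρ) = 0)
    (hθ : ∀ p, θ p = 0 → θ' p = 0) (hθρ : θ' ρ = 0) : TotalResolution c θ' (B ⊕ B) where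
  hd := Sum.elim T.hd (fun b => T.hd b + 1)
  deg := Sum.elim T.deg (fun b => T.deg b + α)
  d := T.coneD ρ
  aug := T.coneAug
  d_hd x y h := by
    classical
    rw [coneD_apply] at h
    rcases x with b | b <;> rcases y with b' | b' <;>
    simp only [coneEquiv_inl, coneEquiv_inr, coneDProd_apply, coneEquiv_symm_inl,
      coneEquiv_symm_inr, map_zero, smul_zero, add_zero, zero_add, neg_zero, Finsupp.neg_apply,
      Finsupp.smul_apply, Finsupp.zero_apply, ne_eq, not_true_eq_false, neg_eq_zero] at h
    · exact T.d_hd _ _ h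
    · have : b = b' := by
        by_contra h0
        simp [h0] at h
      simp [this]
    · simpa using T.d_hd _ _ h
  d_deg x y e he := by
    classical
    rw [coneD_apply] at he
    rcases x with b | b <;> rcases y with b' | b' <;>
    simp only [coneEquiv_inl, coneEquiv_inr, coneDProd_apply, coneEquiv_symm_inl,
      coneEquiv_symm_inr, map_zero, smul_zero, add_zero, zero_add, neg_zero, Finsupp.neg_apply,
      Finsupp.smul_apply, Finsupp.zero_apply, support_neg] at he
    · exact T.d_deg _ _ _ he
    · simp at he
    · have : b = b' := by
        by_contra h0
        simp [h0] at he
      subst this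
      rw [Finsupp.single_eq_same, smul_eq_mul, mul_one] at he
      rw [hρα (mem_support_iff.mp he)]
      exact add_comm _ _
    · change _ + (_ + _) = _ + _
      rw [← add_assoc, T.d_deg _ _ _ he]
  d_minimal x y := by
    rw [coneD_apply]
    rcases x with b | b <;> rcases y with b' | b' <;>
    simp only [coneEquiv_inl, coneEquiv_inr, coneDProd_apply, coneEquiv_symm_inl,
      coneEquiv_symm_inr, map_zero, smul_zero, add_zero, zero_add, neg_zero, Finsupp.neg_apply,
      Finsupp.smul_apply, Finsupp.zero_apply, map_neg, T.d_minimal, smul_eq_mul, map_mul, hρ0,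
      zero_mul]
  aug_hd x h := by
    rw [coneAug_apply] at h
    rcases x with b | b
    · rw [coneEquiv_inl] at h
      exact T.aug_hd _ h
    · rw [coneEquiv_inr] at h
      simp at h
  aug_deg x := by
    rw [coneAug_apply]
    rcases x with b | b
    · rw [coneEquiv_inl]
      exact T.aug_deg _
    · rw [coneEquiv_inr, map_zero]
      exact isWeightedHomogeneous_zero _ _ _
  d_d v := by
    rw [coneD_apply, coneD_apply, LinearEquiv.apply_symm_apply, LinearEquiv.map_eq_zero_iff,
      coneDProd_apply, coneDProd_apply]
    simp [T.d_d]
  aug_d v := by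
    rw [coneAug_apply, coneD_apply, LinearEquiv.apply_symm_apply, coneDProd_apply, map_add,
      map_smul, map_add, hθ _ (T.aug_d _), smul_eq_mul, map_mul, hθρ, zero_mul, add_zero]
  exact v hv hv' := by
    rw [coneD_apply, LinearEquiv.map_eq_zero_iff, coneDProd_apply, Prod.mk_eq_zero,
      neg_eq_zero] at hv
    obtain ⟨u, w, h₁, h₂⟩ := T.cone_exact hρ hker hθρ hv.1 hv.2 hv'
    refine ⟨(coneEquiv _ B).symm (u, w), ?_⟩
    rw [coneD_apply, LinearEquiv.apply_symm_apply, LinearEquiv.symm_apply_eq, coneDProd_apply]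
    exact Prod.ext h₁ h₂
  surj := by
    obtain ⟨w, hw, hw'⟩ := T.surj
    refine ⟨(coneEquiv _ B).symm (w, 0), ?_, ?_⟩
    · rw [coneD_apply, LinearEquiv.apply_symm_apply, LinearEquiv.map_eq_zero_iff, coneDProd_apply]
      simp [hw]
    · rw [coneAug_apply, LinearEquiv.apply_symm_apply, ← sub_eq_zero, ← map_one θ', ← map_sub]
      exact hθ _ (by rw [map_sub, hw', map_one, sub_self])

end Cone

end TotalResolution

/-! ### The toric ideal of a gluing. -/

section ToricIdeal

variable {K : Type*} [Field K] {r : ℕ} {σ τ : Type} {a : σ → Fin r → ℕ} {b : τ → Fin r → ℕ}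

theorem mem_semigroup_iff {c : σ → Fin r → ℕ} {v : Fin r → ℕ} :
    v ∈ semigroup c ↔ ∃ e : σ →₀ ℕ, Finsupp.weight c e = v := by
  constructor
  · intro h
    induction h using AddSubmonoid.closure_induction with
    | mem x hx =>
      obtain ⟨y, rfl⟩ := hx
      exact ⟨Finsupp.single y 1, by simp [Finsupp.weight_single]⟩
    | zero => exact ⟨0, map_zero _⟩
    | add x y _ _ hx hy =>
      obtain ⟨e, rfl⟩ := hx
      obtain ⟨e', rfl⟩ := hy
      exact ⟨e + e', map_add _ _ _⟩
  · rintro ⟨e, rfl⟩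
    rw [Finsupp.weight_apply]
    exact AddSubmonoid.sum_mem _ fun y _ =>
      AddSubmonoid.nsmul_mem _ (AddSubmonoid.subset_closure (Set.mem_range_self y)) _

/-- The exponent of `x^u y^v`. -/
noncomputable def joinExponent (u : σ →₀ ℕ) (v : τ →₀ ℕ) : σ ⊕ τ →₀ ℕ :=
  Finsupp.mapDomain Sum.inl u + Finsupp.mapDomain Sum.inr v

theorem exists_joinExponent (e : σ ⊕ τ →₀ ℕ) : ∃ u v, e = joinExponent u v := by
  induction e using Finsupp.induction_linear with
  | zero => exact ⟨0, 0, by simp [joinExponent]⟩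
  | add e e' h h' =>
    obtain ⟨u, v, rfl⟩ := h
    obtain ⟨u', v', rfl⟩ := h'
    refine ⟨u + u', v + v', ?_⟩
    simp only [joinExponent, Finsupp.mapDomain_add]
    abel
  | single x n =>
    rcases x with x | x
    · exact ⟨Finsupp.single x n, 0, by simp [joinExponent]⟩
    · exact ⟨0, Finsupp.single x n, by simp [joinExponent]⟩

theorem weight_joinExponent (u : σ →₀ ℕ) (v : τ →₀ ℕ) :
    Finsupp.weight (Sum.elim a b) (joinExponent u v) =
      Finsupp.weight a u + Finsupp.weight b v := by
  rw [joinExponent, map_add, weight_mapDomain, weight_mapDomain, Sum.elim_comp_inl,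
    Sum.elim_comp_inr]

theorem weight_prod_joinExponent (u : σ →₀ ℕ) (v : τ →₀ ℕ) :
    Finsupp.weight (prodGenerators a b) (joinExponent u v) =
      (Finsupp.weight a u, Finsupp.weight b v) := by
  rw [joinExponent, map_add, weight_mapDomain, weight_mapDomain, weight_prod_inl, weight_prod_inr]
  simp

theorem prodToricMap_monomial (e : σ ⊕ τ →₀ ℕ) (x : K) :
    prodToricMap K a b (monomial e x) =
      AddMonoidAlgebra.single (Finsupp.weight (prodGenerators a b) e) x := by
  rw [prodToricMap, aeval_single_monomial]

/-- The addition map ℕ^r × ℕ^r → ℕ^r factors one parametrization through the other. -/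
theorem toricMap_eq_zero_of_prodToricMap {p : MvPolynomial (σ ⊕ τ) K}
    (h : prodToricMap K a b p = 0) : toricMap K (Sum.elim a b) p = 0 := by
  let f : (Fin r → ℕ) × (Fin r → ℕ) →+ (Fin r → ℕ) :=
    AddMonoidHom.coprod (AddMonoidHom.id _) (AddMonoidHom.id _)
  have : (AddMonoidAlgebra.mapDomainAlgHom K K f).comp (prodToricMap K a b) =
      toricMap K (Sum.elim a b) := by
    ext1 x
    rcases x with x | x <;> simp [prodToricMap, toricMap, prodGenerators, f]
  rw [← this, AlgHom.comp_apply, h, map_zero]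

/-- The binomial `x^μ - y^ν`. -/
noncomputable def gluingBinomial (K : Type*) [Field K] (μ : σ →₀ ℕ) (ν : τ →₀ ℕ) :
    MvPolynomial (σ ⊕ τ) K :=
  monomial (joinExponent μ 0) 1 - monomial (joinExponent 0 ν) 1

variable {μ : σ →₀ ℕ} {ν : τ →₀ ℕ} {α : Fin r → ℕ}

theorem gluingBinomial_homogeneous (hμ : Finsupp.weight a μ = α) (hν : Finsupp.weight b ν = α) :
    IsWeightedHomogeneous (Sum.elim a b) (gluingBinomial K μ ν) α := by
  refine Submodule.sub_mem (weightedHomogeneousSubmodule K (Sum.elim a b) α)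
    (isWeightedHomogeneous_monomial _ _ _ ?_) (isWeightedHomogeneous_monomial _ _ _ ?_)
  · rw [weight_joinExponent, hμ, map_zero, add_zero]
  · rw [weight_joinExponent, hν, map_zero, zero_add]

theorem toricMap_gluingBinomial (hμ : Finsupp.weight a μ = α) (hν : Finsupp.weight b ν = α) :
    toricMap K (Sum.elim a b) (gluingBinomial K μ ν) = 0 := by
  rw [gluingBinomial, map_sub, toricMap_monomial, toricMap_monomial, weight_joinExponent,
    weight_joinExponent, hμ, hν, map_zero, map_zero, add_zero, zero_add, sub_self]

/-- The two monomials have bidegrees (α, 0) and (0, α), which differ as α ≠ 0. -/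
theorem prodToricMap_gluingBinomial_ne_zero (hα : α ≠ 0) (hμ : Finsupp.weight a μ = α)
    (hν : Finsupp.weight b ν = α) : prodToricMap K a b (gluingBinomial K μ ν) ≠ 0 := by
  rw [gluingBinomial, map_sub, prodToricMap_monomial, prodToricMap_monomial,
    weight_prod_joinExponent, weight_prod_joinExponent, hμ, hν, map_zero, map_zero, sub_ne_zero]
  intro h
  have := AddMonoidAlgebra.single_left_injective (one_ne_zero (α := K)) h
  exact hα (Prod.ext_iff.mp this).1

theorem constantCoeff_gluingBinomial (hα : α ≠ 0) (hμ : Finsupp.weight a μ = α)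
    (hν : Finsupp.weight b ν = α) : constantCoeff (gluingBinomial K μ ν) = 0 := by
  classical
  have h1 : joinExponent μ (0 : τ →₀ ℕ) ≠ 0 := by
    intro h
    have := weight_joinExponent (a := a) (b := b) μ 0
    rw [h, hμ, map_zero, map_zero, add_zero] at this
    exact hα this.symm
  have h2 : joinExponent (0 : σ →₀ ℕ) ν ≠ 0 := by
    intro h
    have := weight_joinExponent (a := a) (b := b) 0 ν
    rw [h, hν, map_zero, map_zero, zero_add] at this
    exact hα this.symm
  rw [constantCoeff_eq, gluingBinomial, coeff_sub, coeff_monomial, coeff_monomial, if_neg h1,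
    if_neg h2, sub_self]

/-- The ideal `I_{S₁} + I_{S₂} + (x^μ - y^ν)`. -/
noncomputable def gluingIdeal (K : Type*) [Field K] (a : σ → Fin r → ℕ) (b : τ → Fin r → ℕ)
    (μ : σ →₀ ℕ) (ν : τ →₀ ℕ) : Ideal (MvPolynomial (σ ⊕ τ) K) :=
  RingHom.ker (prodToricMap K a b) ⊔ Ideal.span {gluingBinomial K μ ν}

theorem sub_mem_gluingIdeal {e e' : σ ⊕ τ →₀ ℕ}
    (h : Finsupp.weight (prodGenerators a b) e = Finsupp.weight (prodGenerators a b) e') :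
    monomial e (1 : K) - monomial e' 1 ∈ gluingIdeal K a b μ ν := by
  refine Ideal.mem_sup_left ?_
  rw [RingHom.mem_ker, map_sub, prodToricMap_monomial, prodToricMap_monomial, h, sub_self]

/-- Pass from x^u y^v to x^{kμ} x^{u'} y^v, then to y^{kν} x^{u'} y^v, then to x^{u'} y^{v'}. The
outer moves preserve the bidegree, and the middle difference is a multiple of ρ. -/
theorem sub_mem_gluingIdeal_of_nsmul (hμ : Finsupp.weight a μ = α) (hν : Finsupp.weight b ν = α)
    {u u' : σ →₀ ℕ} {v v' : τ →₀ ℕ} (k : ℕ)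
    (hu : Finsupp.weight a u = Finsupp.weight a u' + k • α)
    (hv : Finsupp.weight b v' = Finsupp.weight b v + k • α) :
    monomial (joinExponent u v) (1 : K) - monomial (joinExponent u' v') 1 ∈
      gluingIdeal K a b μ ν := by
  have h1 : monomial (joinExponent u v) (1 : K) -
      monomial (k • joinExponent μ 0 + joinExponent u' v) 1 ∈ gluingIdeal K a b μ ν := by
    refine sub_mem_gluingIdeal ?_
    rw [map_add, map_nsmul, weight_prod_joinExponent, weight_prod_joinExponent,
      weight_prod_joinExponent, hu, hμ]
    simp [add_comm]
  have h2 : monomial (k • joinExponent 0 ν + joinExponent u' v) (1 : K) -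
      monomial (joinExponent u' v') 1 ∈ gluingIdeal K a b μ ν := by
    refine sub_mem_gluingIdeal ?_
    rw [map_add, map_nsmul, weight_prod_joinExponent, weight_prod_joinExponent,
      weight_prod_joinExponent, hv, hν]
    simp [add_comm]
  have h3 : monomial (k • joinExponent μ 0 + joinExponent u' v) (1 : K) -
      monomial (k • joinExponent 0 ν + joinExponent u' v) 1 ∈ gluingIdeal K a b μ ν := by
    refine Ideal.mem_sup_right (Ideal.mem_span_singleton.mpr ?_)
    have h4 : ∀ e e' : σ ⊕ τ →₀ ℕ,
        monomial (k • e + e') (1 : K) = monomial e 1 ^ k * monomial e' 1 := by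
      intro e e'
      rw [monomial_pow, monomial_mul, one_pow, one_mul]
    rw [h4, h4, ← sub_mul]
    exact Dvd.dvd.mul_right (sub_dvd_pow_sub_pow _ _ _) _
  convert add_mem (add_mem h1 h3) h2 using 1
  abel

theorem toInt_injective : Function.Injective (toInt (r := r)) := fun v w h => by
  funext k
  have := congrFun h k
  simpa [toInt] using this

theorem toInt_add (v w : Fin r → ℕ) : toInt (v + w) = toInt v + toInt w := by
  funext k
  simp [toInt]

theorem toInt_nsmul (n : ℕ) (v : Fin r → ℕ) : toInt (n • v) = n • toInt v := by
  funext k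
  simp [toInt]

theorem toInt_mem_groupOf {S : AddSubmonoid (Fin r → ℕ)} {v : Fin r → ℕ} (h : v ∈ S) :
    toInt v ∈ groupOf S :=
  AddSubgroup.subset_closure ⟨v, h, rfl⟩

/-- The only use of ℤS₁ ∩ ℤS₂ = ℤα: equal total degrees force the x-degrees to differ by an integer
multiple kα, and the y-degrees by the opposite amount. -/
theorem monomial_sub_mem_gluingIdeal
    (hinf : groupOf (semigroup a) ⊓ groupOf (semigroup b) = AddSubgroup.zmultiples (toInt α))
    (hμ : Finsupp.weight a μ = α) (hν : Finsupp.weight b ν = α) {e e' : σ ⊕ τ →₀ ℕ}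
    (h : Finsupp.weight (Sum.elim a b) e = Finsupp.weight (Sum.elim a b) e') :
    monomial e (1 : K) - monomial e' 1 ∈ gluingIdeal K a b μ ν := by
  obtain ⟨u, v, rfl⟩ := exists_joinExponent e
  obtain ⟨u', v', rfl⟩ := exists_joinExponent e'
  rw [weight_joinExponent, weight_joinExponent] at h
  have h0 := congrArg toInt h
  rw [toInt_add, toInt_add] at h0
  have h1 : toInt (Finsupp.weight a u) - toInt (Finsupp.weight a u') =
      toInt (Finsupp.weight b v') - toInt (Finsupp.weight b v) := by
    rw [sub_eq_sub_iff_add_eq_add, h0, add_comm]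
  have h2 : toInt (Finsupp.weight a u) - toInt (Finsupp.weight a u') ∈
      AddSubgroup.zmultiples (toInt α) := by
    rw [← hinf]
    refine AddSubgroup.mem_inf.mpr ⟨sub_mem (toInt_mem_groupOf (mem_semigroup_iff.mpr ⟨_, rfl⟩))
      (toInt_mem_groupOf (mem_semigroup_iff.mpr ⟨_, rfl⟩)), ?_⟩
    rw [h1]
    exact sub_mem (toInt_mem_groupOf (mem_semigroup_iff.mpr ⟨_, rfl⟩))
      (toInt_mem_groupOf (mem_semigroup_iff.mpr ⟨_, rfl⟩))
  obtain ⟨k, hk⟩ := AddSubgroup.mem_zmultiples_iff.mp h2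
  obtain ⟨n, rfl | rfl⟩ := Int.eq_nat_or_neg k
  · refine sub_mem_gluingIdeal_of_nsmul hμ hν n (toInt_injective ?_) (toInt_injective ?_)
    · rw [toInt_add, toInt_nsmul, ← natCast_zsmul, hk]
      abel
    · rw [toInt_add, toInt_nsmul, ← natCast_zsmul, hk, h1]
      abel
  -- For negative k the two monomials trade places.
  · rw [← neg_mem_iff, neg_sub]
    refine sub_mem_gluingIdeal_of_nsmul hμ hν n (toInt_injective ?_) (toInt_injective ?_)
    · rw [toInt_add, toInt_nsmul, ← natCast_zsmul, ← neg_neg ((n : ℤ) • toInt α), ← neg_smul, hk]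
      abel
    · rw [toInt_add, toInt_nsmul, ← natCast_zsmul, ← neg_neg ((n : ℤ) • toInt α), ← neg_smul, hk,
        h1]
      abel

/-- Sending each degree to the class of a chosen monomial of that degree gives a linear `L` whose
composite with the toric map is the quotient map, so the toric kernel lies in the ideal. -/
theorem mem_gluingIdeal_of_toricMap_eq_zero
    (hinf : groupOf (semigroup a) ⊓ groupOf (semigroup b) = AddSubgroup.zmultiples (toInt α))
    (hμ : Finsupp.weight a μ = α) (hν : Finsupp.weight b ν = α) {p : MvPolynomial (σ ⊕ τ) K}
    (hp : toricMap K (Sum.elim a b) p = 0) : p ∈ gluingIdeal K a b μ ν := by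
  classical
  let rep : (Fin r → ℕ) → MvPolynomial (σ ⊕ τ) K ⧸ gluingIdeal K a b μ ν := fun t =>
    if h : ∃ e, Finsupp.weight (Sum.elim a b) e = t then
      -- The value 0 is harmless: degrees outside S do not occur in the image of the toric map.
      Ideal.Quotient.mk _ (monomial h.choose 1) else 0
  let L := Finsupp.linearCombination K rep ∘ₗ
    (AddMonoidAlgebra.coeffLinearEquiv K : AddMonoidAlgebra K (Fin r → ℕ) ≃ₗ[K] _).toLinearMap
  have key : ∀ q : MvPolynomial (σ ⊕ τ) K,
      L (toricMap K (Sum.elim a b) q) = Ideal.Quotient.mk (gluingIdeal K a b μ ν) q := by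
    intro q
    induction q using MvPolynomial.induction_on' with
    | add p q hp hq => rw [map_add, map_add, map_add, hp, hq]
    | monomial e x =>
      rw [toricMap_monomial]
      have h : ∃ e', Finsupp.weight (Sum.elim a b) e' = Finsupp.weight (Sum.elim a b) e := ⟨e, rfl⟩
      have h1 : rep (Finsupp.weight (Sum.elim a b) e) =
          Ideal.Quotient.mk (gluingIdeal K a b μ ν) (monomial e 1) := by
        simp only [rep, dif_pos h]
        exact Ideal.Quotient.eq.mpr (monomial_sub_mem_gluingIdeal hinf hμ hν h.choose_spec)
      have h2 : monomial e x = x • monomial e (1 : K) := by rw [smul_monomial, smul_eq_mul, mul_one]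
      have h3 : L (AddMonoidAlgebra.single (Finsupp.weight (Sum.elim a b) e) x) =
          x • rep (Finsupp.weight (Sum.elim a b) e) := by
        simp [L]
      rw [h3, h1, h2]
      rfl
  rw [← Ideal.Quotient.eq_zero_iff_mem, ← key, hp, map_zero]

theorem exists_sub_mul_gluingBinomial
    (hinf : groupOf (semigroup a) ⊓ groupOf (semigroup b) = AddSubgroup.zmultiples (toInt α))
    (hμ : Finsupp.weight a μ = α) (hν : Finsupp.weight b ν = α) (p : MvPolynomial (σ ⊕ τ) K)
    (hp : toricMap K (Sum.elim a b) p = 0) :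
    ∃ q, prodToricMap K a b (p - q * gluingBinomial K μ ν) = 0 := by
  obtain ⟨j, hj, x, hx, rfl⟩ :=
    Submodule.mem_sup.mp (mem_gluingIdeal_of_toricMap_eq_zero hinf hμ hν hp)
  obtain ⟨q, rfl⟩ := Ideal.mem_span_singleton'.mp hx
  exact ⟨q, by rwa [add_sub_cancel_right]⟩

end ToricIdeal

/-! ### Counting basis elements by homological degree. -/

section Levels

theorem sumset_map {ι κ M : Type*} [Add M] (f : ι → M) (g : κ → M) (A : Multiset ι)
    (B : Multiset κ) : sumset (A.map f) (B.map g) = (A ×ˢ B).map (fun x => f x.1 + g x.2) := by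
  induction A using Multiset.induction_on with
  | empty => simp [sumset]
  | cons x A ih =>
    simp only [sumset, Multiset.map_cons, Multiset.cons_product, Multiset.map_add,
      Multiset.map_map] at ih ⊢
    rw [ih]
    rfl

theorem sumset_singleton {M : Type*} [Add M] (A : Multiset M) (x : M) :
    sumset A {x} = A.map (· + x) := by
  induction A using Multiset.induction_on with
  | empty => simp [sumset]
  | cons y A ih =>
    simp only [sumset, Multiset.cons_product, Multiset.map_add, Multiset.map_cons,
      Multiset.map_singleton] at ih ⊢
    rw [ih]
    rfl

/-- The pairs of total degree `i`. -/
def pairLevel {B₁ B₂ : Type} (L₁ : ℕ → Finset B₁) (L₂ : ℕ → Finset B₂)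
    [DecidableEq B₁] [DecidableEq B₂] (i : ℕ) : Finset (B₁ × B₂) :=
  (Finset.HasAntidiagonal.antidiagonal i).biUnion fun pq => L₁ pq.1 ×ˢ L₂ pq.2

variable {B₁ B₂ : Type} [DecidableEq B₁] [DecidableEq B₂] {L₁ : ℕ → Finset B₁}
  {L₂ : ℕ → Finset B₂} {h₁ : B₁ → ℕ} {h₂ : B₂ → ℕ}

theorem mem_pairLevel (hL₁ : ∀ i x, x ∈ L₁ i ↔ h₁ x = i) (hL₂ : ∀ i x, x ∈ L₂ i ↔ h₂ x = i)
    (i : ℕ) (x : B₁ × B₂) : x ∈ pairLevel L₁ L₂ i ↔ h₁ x.1 + h₂ x.2 = i := by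
  simp [pairLevel, hL₁, hL₂]

theorem map_pairLevel {M : Type*} [AddCommMonoid M] (hL₁ : ∀ i x, x ∈ L₁ i ↔ h₁ x = i)
    (hL₂ : ∀ i x, x ∈ L₂ i ↔ h₂ x = i) (f : B₁ → M) (g : B₂ → M) (i : ℕ) :
    (pairLevel L₁ L₂ i).val.map (fun x => f x.1 + g x.2) =
      ∑ pq ∈ Finset.HasAntidiagonal.antidiagonal i,
        sumset ((L₁ pq.1).val.map f) ((L₂ pq.2).val.map g) := by
  have hd : (Finset.HasAntidiagonal.antidiagonal i : Set (ℕ × ℕ)).PairwiseDisjoint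
      (fun pq => L₁ pq.1 ×ˢ L₂ pq.2) := by
    intro pq _ pq' _ hne
    refine Finset.disjoint_left.mpr fun x hx hx' => hne ?_
    simp only [Finset.mem_product, hL₁, hL₂] at hx hx'
    exact Prod.ext (hx.1.symm.trans hx'.1) (hx.2.symm.trans hx'.2)
  rw [pairLevel, ← Finset.disjiUnion_eq_biUnion _ _ hd, Finset.disjiUnion_val, Multiset.map_bind]
  simp only [sumset_map]
  rfl

/-- The box with sides `range (j + 1)` already contains every pair of sum `j`, so the filter loses
nothing. -/
theorem filter_range_eq_antidiagonal (j : ℕ) :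
    (Finset.range (j + 1) ×ˢ Finset.range (j + 1)).filter (fun pq => pq.1 + pq.2 + 1 = j + 1) =
      Finset.HasAntidiagonal.antidiagonal j := by
  ext ⟨p, q⟩
  simp only [Finset.mem_filter, Finset.mem_product, Finset.mem_range,
    Finset.HasAntidiagonal.mem_antidiagonal]
  omega

end Levels

/-! ### The resolution of the glued semigroup ring. -/

/-- The basis elements of homological degree `i` of the total resolution. -/
def MinimalResolution.level {K : Type*} [Field K] {r : ℕ} {σ : Type} {c : σ → Fin r → ℕ}
    (F : MinimalResolution K c) (i : ℕ) : Finset (Σ i, Fin (F.rank i)) :=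
  Finset.univ.map (Function.Embedding.sigmaMk i)

theorem MinimalResolution.mem_level {K : Type*} [Field K] {r : ℕ} {σ : Type} {c : σ → Fin r → ℕ}
    (F : MinimalResolution K c) (i : ℕ) (x) : x ∈ F.level i ↔ F.total.hd x = i := by
  obtain ⟨k, j⟩ := x
  constructor
  · intro h
    obtain ⟨j', -, h'⟩ := Finset.mem_map.mp h
    exact (congrArg Sigma.fst h').symm
  · rintro rfl
    exact Finset.mem_map.mpr ⟨j, Finset.mem_univ _, rfl⟩

theorem MinimalResolution.map_level {K : Type*} [Field K] {r : ℕ} {σ : Type} {c : σ → Fin r → ℕ}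
    (F : MinimalResolution K c) (i : ℕ) : (F.level i).val.map F.total.deg = F.betti i := by
  rw [level, Finset.map_val, Multiset.map_map]
  rfl

theorem exists_minimalResolution_of_gluing (K : Type*) [Field K] {r : ℕ} {σ τ : Type}
    {a : σ → Fin r → ℕ} {b : τ → Fin r → ℕ} {α : Fin r → ℕ}
    (hglue : IsGluing (semigroup (Sum.elim a b)) (semigroup a) (semigroup b) α)
    (F : MinimalResolution K a) (G : MinimalResolution K b) :
    ∃ H : MinimalResolution K (Sum.elim a b), ∀ i, H.betti i =
      (∑ pq ∈ Finset.HasAntidiagonal.antidiagonal i, sumset (F.betti pq.1) (G.betti pq.2)) +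
        (∑ pq ∈ (Finset.range i ×ˢ Finset.range i).filter (fun pq => pq.1 + pq.2 + 1 = i),
          sumset (sumset (F.betti pq.1) (G.betti pq.2)) {α}) := by
  classical
  obtain ⟨μ, hμ⟩ := mem_semigroup_iff.mp hglue.mem_left
  obtain ⟨ν, hν⟩ := mem_semigroup_iff.mp hglue.mem_right
  let T := (F.total.tensor G.total).cone (toricMap K (Sum.elim a b)) (gluingBinomial K μ ν) α
    (gluingBinomial_homogeneous hμ hν) (constantCoeff_gluingBinomial hglue.ne_zero hμ hν)
    (prodToricMap_gluingBinomial_ne_zero hglue.ne_zero hμ hν)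
    (exists_sub_mul_gluingBinomial hglue.inf_eq hμ hν)
    (fun _ => toricMap_eq_zero_of_prodToricMap) (toricMap_gluingBinomial hμ hν)
  let L := pairLevel F.level G.level
  have hL : ∀ i x, x ∈ L i ↔ F.total.hd x.1 + G.total.hd x.2 = i :=
    mem_pairLevel F.mem_level G.mem_level
  -- The second copy is shifted by one. The case `i = 0` is separate because `i - 1` would truncate
  -- to 0 and count degree zero again.
  let L' : ℕ → Finset _ := fun i => (L i).disjSum (if i = 0 then ∅ else L (i - 1))
  have hL' : ∀ i x, x ∈ L' i ↔ T.hd x = i := by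
    intro i x
    rcases x with x | x
    · rw [Finset.inl_mem_disjSum]
      exact hL i x
    · rw [Finset.inr_mem_disjSum]
      change _ ↔ F.total.hd x.1 + G.total.hd x.2 + 1 = i
      split_ifs with h
      · simp [h]
      · rw [hL]
        omega
  have : ∀ i, Finite {x // T.hd x = i} := fun i =>
    Finite.of_equiv (L' i) (Equiv.subtypeEquivRight (hL' i))
  have hdeg : ∀ i, (L i).val.map (fun x => F.total.deg x.1 + G.total.deg x.2) =
      ∑ pq ∈ Finset.HasAntidiagonal.antidiagonal i, sumset (F.betti pq.1) (G.betti pq.2) := by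
    intro i
    simp only [← MinimalResolution.map_level]
    exact map_pairLevel F.mem_level G.mem_level _ _ i
  refine ⟨T.toMinimal, fun i => ?_⟩
  rw [T.toMinimal_betti i (L' i) (hL' i), ← hdeg]
  rw [Finset.val_disjSum, Multiset.disjSum, Multiset.map_add, Multiset.map_map, Multiset.map_map]
  congr 1
  rcases i with _ | j
  · simp
  · rw [if_neg (Nat.succ_ne_zero j), filter_range_eq_antidiagonal]
    simp only [sumset_singleton]
    have hs := map_sum (Multiset.mapAddMonoidHom (· + α))
      (fun pq : ℕ × ℕ => sumset (F.betti pq.1) (G.betti pq.2))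
      (Finset.HasAntidiagonal.antidiagonal j)
    simp only [Multiset.coe_mapAddMonoidHom] at hs
    rw [← hs, ← hdeg, Multiset.map_map]
    rfl

end AffineSemigroup

theorem lemma3p4 (K : Type*) [Field K] (r m n : ℕ)
    (a : Fin m → Fin r → ℕ) (b : Fin n → Fin r → ℕ) (α : Fin r → ℕ)
    (ha : ∀ j, a j ≠ 0) (hb : ∀ j, b j ≠ 0)
    (hglue : IsGluing (semigroup (Sum.elim a b)) (semigroup a) (semigroup b) α)
    (F : MinimalResolution K a) (G : MinimalResolution K b) :
    Nonempty (MinimalResolution K (Sum.elim a b)) ∧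
    ∀ (H : MinimalResolution K (Sum.elim a b)) (i : ℕ),
      H.betti i =
        (∑ pq ∈ Finset.HasAntidiagonal.antidiagonal i, sumset (F.betti pq.1) (G.betti pq.2)) +
        (∑ pq ∈ (Finset.range i ×ˢ Finset.range i).filter (fun pq => pq.1 + pq.2 + 1 = i),
          sumset (sumset (F.betti pq.1) (G.betti pq.2)) {α}) := by
  obtain ⟨H₀, h⟩ := exists_minimalResolution_of_gluing K hglue F G
  exact ⟨⟨H₀⟩, fun H i => (H.betti_eq H₀ i).trans (h i)⟩
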